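/- **Setting.** Let $V,H$ be separable real Hilbert spaces with $V\hookrightarrow H$ densely and compactly, $V\hookrightarrow H\simeq H'\hookrightarrow V'$ the resulting Gelfand triple, $\langle\cdot,\cdot\rangle$ the scalar product of $H$ and its extension to the duality pairing on $V'\times V$, $\|\cdot\|$ the norm of $H$, and $I=(0,T)$ with $0<T<\infty$. For a.e. $t\in I$ let $a(t;\cdot,\cdot)$ be a bilinear form on $V\times V$ such that $t\mapsto a(t;\eta,\zeta)$ is measurable for all $\eta,\zeta\in V$, and such that for constants $M$ and $c>0$ and a.e. $t\in I$, $|a(t;\eta,\zeta)|\le M\|\eta\|_V\|\zeta\|_V$ and $a(t;\eta,\eta)\ge c\|\eta\|_V^2$ for all $\eta,\zeta\in V$. Let $Y=L_2(I;V)$, $X=L_2(I;V)\cap H^1(I;V')$, and let $\gamma_t u=u(t)\in H$ be the trace of $u\in X$ at $t\in[0,T]$, i.e. the value at $t$ of its representative in $C([0,T];H)$. Put $$(\partial_t w)(v)=\int_I\langle \tfrac{dw}{dt}(t),v(t)\rangle\,dt,\quad (Au)(v)=\int_I a(t;u(t),v(t))\,dt,\quad B=\partial_t+A,\quad A_s=\tfrac12(A+A'),$$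 and equip $Y$ and $X$ with the energy norms $\|v\|_Y^2=(A_sv)(v)$ and $\|u\|_X^2=\|u\|_Y^2+\|\partial_tu\|_{Y'}^2+\|u(T)\|^2$, where $\|f\|_{Y'}=\sup_{0\ne v\in Y}f(v)/\|v\|_Y$. **Theorem.** Assume $A=A_s$. Let $(Y^\delta,H^\delta,X^\delta)_{\delta\in\Delta}$ be a family of closed subspaces $Y^\delta\subseteq Y$, $H^\delta\subseteq H$, $X^\delta\subseteq X$ such that, for all $\delta\in\Delta$, $X^\delta\subseteq Y^\delta$ and $u(0)\in H^\delta$ for all $u\in X^\delta$, and such that $$\gamma_\Delta:=\inf_{\delta\in\Delta}\ \inf_{\{u\in X^\delta:\,\partial_tu\ne0\}}\ \sup_{0\ne v\in Y^\delta}\frac{(\partial_tu)(v)}{\|\partial_tu\|_{Y'}\|v\|_Y}>0,$$ where the inner infimum is read as $1$ if $\{u\in X^\delta:\partial_tu\neq0\}=\emptyset$. Let $\delta\in\Delta$, $g\in Y'$ and $u_0\in H$. Then there is a unique Galerkin solution $(\mu^\delta,\sigma^\delta,u^\delta)\in Y^\delta\times H^\delta\times X^\delta$ of $$\begin{aligned}(A_s\mu^\delta)(v)+(Bu^\delta)(v)&=g(v)&&(v\in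 Y^\delta),\\ \langle\sigma^\delta,h\rangle+\langle u^\delta(0),h\rangle&=\langle u_0,h\rangle&&(h\in H^\delta),\\ (Bw)(\mu^\delta)+\langle w(0),\sigma^\delta\rangle&=0&&(w\in X^\delta),\end{aligned}$$ and if $u\in X$ solves $(Bu)(v_1)+\langle u(0),v_2\rangle=g(v_1)+\langle u_0,v_2\rangle$ for all $(v_1,v_2)\in Y\times H$, then $$\|u-u^\delta\|_X\le\gamma_\Delta^{-1}\inf_{\bar u^\delta\in X^\delta}\|u-\bar u^\delta\|_X .$$ -/

import Mathlib

open MeasureTheory Set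

namespace SpaceTime

noncomputable section

/-! ### Bochner spaces over the time interval `I = (0, T)` -/

/-- Lebesgue measure on the time interval `I = (0, T)`. -/
abbrev timeMeasure (T : ℝ) : Measure ℝ := volume.restrict (Ioo 0 T)

/-- The Bochner space `L₂(I; E)`. -/
abbrev L2I (T : ℝ) (E : Type*) [NormedAddCommGroup E] : Type _ :=
  Lp E 2 (timeMeasure T)

theorem integrable_L2I {T : ℝ} {E : Type*} [NormedAddCommGroup E] (u : L2I T E) :
    Integrable (fun t => u t) (timeMeasure T) :=
  haveI : IsFiniteMeasure (timeMeasure T) := ⟨by simp [timeMeasure]⟩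
  (Lp.memLp u).integrable (by norm_num)

theorem integrable_smul_L2I {T : ℝ} {E : Type*} [NormedAddCommGroup E] [NormedSpace ℝ E]
    {f : ℝ → E} (hf : Integrable f (timeMeasure T))
    {φ : ℝ → ℝ} (hφ : Continuous φ) (hc : HasCompactSupport φ) :
    Integrable (fun t => φ t • f t) (timeMeasure T) := by
  obtain ⟨C, hC⟩ := hφ.bounded_above_of_compact_support hc
  exact hf.bdd_smul C hφ.aestronglyMeasurable (Filter.Eventually.of_forall hC)

section Spaces

variable {V H : Type*}
  [NormedAddCommGroup V] [InnerProductSpace ℝ V]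
  [NormedAddCommGroup H] [InnerProductSpace ℝ H]

/-- The embedding `V ↪ H ≃ H' ↪ V'` of the Gelfand triple, `η ↦ (ζ ↦ ⟨η, ζ⟩_H)`, where
`j : V → H` is the embedding of `V` into `H`. -/
def gelfand (j : V →L[ℝ] H) : V →L[ℝ] StrongDual ℝ V :=
  (innerSL ℝ : H →L[ℝ] H →L[ℝ] ℝ).bilinearComp j j

/-- `w ∈ L₂(I; V')` is the weak (distributional) derivative on `I` of `u ∈ L₂(I; V)`, the latter
viewed as a `V'`-valued function. -/
def HasWeakDeriv (T : ℝ) (j : V →L[ℝ] H) (u : L2I T V) (w : L2I T (StrongDual ℝ V)) : Prop :=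
  ∀ φ : ℝ → ℝ, ContDiff ℝ (⊤ : ℕ∞) φ → HasCompactSupport φ → tsupport φ ⊆ Ioo 0 T →
    ∫ t in Ioo 0 T, deriv φ t • gelfand j (u t) = -∫ t in Ioo 0 T, φ t • w t

/-- The space `X = L₂(I; V) ∩ H¹(I; V')`. An element is a function `u ∈ L₂(I; V)` together with its
(uniquely determined) weak derivative `du/dt ∈ L₂(I; V')`. The topology is the one inherited from
`L₂(I; V) × L₂(I; V')`, i.e. that of the graph norm, the standard norm of `X`. -/
def spaceX (T : ℝ) (j : V →L[ℝ] H) : Submodule ℝ (L2I T V × L2I T (StrongDual ℝ V)) where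
  carrier := {p | HasWeakDeriv T j p.1 p.2}
  zero_mem' := by
    intro φ _ _ _
    have h1 : (fun t => deriv φ t • gelfand j ((0 : L2I T V) t)) =ᵐ[timeMeasure T] 0 := by
      filter_upwards [Lp.coeFn_zero V 2 (timeMeasure T)] with t ht
      rw [ht]
      simp
    have h2 : (fun t => φ t • ((0 : L2I T (StrongDual ℝ V)) t)) =ᵐ[timeMeasure T] 0 := by
      filter_upwards [Lp.coeFn_zero (StrongDual ℝ V) 2 (timeMeasure T)] with t ht
      rw [ht]
      simp
    simp only [Prod.fst_zero, Prod.snd_zero]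
    rw [integral_congr_ae h1, integral_congr_ae h2]
    simp
  add_mem' := by
    intro p q hp hq φ h1 h2 h3
    have hd : Continuous (deriv φ) := h1.continuous_deriv (by simp)
    have e1 : (fun t => deriv φ t • gelfand j ((p.1 + q.1 : L2I T V) t)) =ᵐ[timeMeasure T]
        fun t => deriv φ t • gelfand j (p.1 t) + deriv φ t • gelfand j (q.1 t) := by
      filter_upwards [Lp.coeFn_add p.1 q.1] with t ht
      rw [ht]
      simp
    have e2 : (fun t => φ t • ((p.2 + q.2 : L2I T (StrongDual ℝ V)) t)) =ᵐ[timeMeasure T]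
        fun t => φ t • p.2 t + φ t • q.2 t := by
      filter_upwards [Lp.coeFn_add p.2 q.2] with t ht
      rw [ht]
      simp
    have i1 := fun u : L2I T V => integrable_smul_L2I
      ((gelfand j).integrable_comp (integrable_L2I u)) hd h2.deriv
    have i2 := fun u : L2I T (StrongDual ℝ V) => integrable_smul_L2I
      (integrable_L2I u) h1.continuous h2
    simp only [Prod.fst_add, Prod.snd_add]
    rw [integral_congr_ae e1, integral_congr_ae e2, integral_add (i1 _) (i1 _),
      integral_add (i2 _) (i2 _), hp φ h1 h2 h3, hq φ h1 h2 h3, neg_add]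
  smul_mem' := by
    intro c p hp φ h1 h2 h3
    have e1 : (fun t => deriv φ t • gelfand j ((c • p.1 : L2I T V) t)) =ᵐ[timeMeasure T]
        fun t => c • (deriv φ t • gelfand j (p.1 t)) := by
      filter_upwards [Lp.coeFn_smul c p.1] with t ht
      rw [ht]
      simp [smul_comm c]
    have e2 : (fun t => φ t • ((c • p.2 : L2I T (StrongDual ℝ V)) t)) =ᵐ[timeMeasure T]
        fun t => c • (φ t • p.2 t) := by
      filter_upwards [Lp.coeFn_smul c p.2] with t ht
      rw [ht]
      simp [smul_comm c]
    simp only [Prod.smul_fst, Prod.smul_snd]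
    rw [integral_congr_ae e1, integral_congr_ae e2, integral_smul, integral_smul,
      hp φ h1 h2 h3, smul_neg]

variable {T : ℝ} {j : V →L[ℝ] H}

/-- The underlying function in `Y = L₂(I; V)` of an element of `X`. -/
def toY (u : spaceX T j) : L2I T V := u.1.1

/-- The weak time derivative `du/dt ∈ L₂(I; V')` of an element of `X`. -/
def timeDeriv (u : spaceX T j) : L2I T (StrongDual ℝ V) := u.1.2

/-- `U` is the continuous representative `[0, T] → H` of `u ∈ X`. -/
def IsContinuousRep (u : spaceX T j) (U : ℝ → H) : Prop :=
  ContinuousOn U (Icc 0 T) ∧ ∀ᵐ t ∂(timeMeasure T), U t = j (toY u t)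

open Classical in
/-- The trace `γ_t u = u(t) ∈ H`, for `t ∈ [0, T]`: the value at `t` of the continuous
representative of `u`. (The representative exists for every `u ∈ X`, by the embedding
`X ↪ C([0, T]; H)`, and its values on `[0, T]` are unique; the `else` branch never occurs.) -/
def trace (t : ℝ) (u : spaceX T j) : H :=
  if h : ∃ U, IsContinuousRep u U then h.choose t else 0

/-! ### The operators. An operator into a dual space is given by its values `(L w)(v)`. -/

/-- The operator `∂ₜ : X → Y'`, `(∂ₜ w)(v) = ∫_I ⟨dw/dt, v⟩ dt`. -/
def opDt (w : spaceX T j) (v : L2I T V) : ℝ :=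
  ∫ t in Ioo 0 T, timeDeriv w t (v t)

/-- The operator `A : Y → Y'`, `(A u)(v) = ∫_I a(t; u(t), v(t)) dt`. -/
def opA (a : ℝ → V →ₗ[ℝ] V →ₗ[ℝ] ℝ) (u v : L2I T V) : ℝ :=
  ∫ t in Ioo 0 T, a t (u t) (v t)

/-- The symmetric part `A_s = (A + A') / 2`. -/
def opAs (a : ℝ → V →ₗ[ℝ] V →ₗ[ℝ] ℝ) (u v : L2I T V) : ℝ :=
  (opA a u v + opA a v u) / 2

/-- The operator `B : X → Y'`, `(B w)(v) = ∫_I ⟨dw/dt, v⟩ + a(t; w(t), v(t)) dt`. -/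
def opB (a : ℝ → V →ₗ[ℝ] V →ₗ[ℝ] ℝ) (w : spaceX T j) (v : L2I T V) : ℝ :=
  ∫ t in Ioo 0 T, (timeDeriv w t (v t) + a t (toY w t) (v t))

/-! ### Energy norms -/

/-- The energy norm on `Y`, `‖v‖_Y² = (A_s v)(v)`. -/
def normY (a : ℝ → V →ₗ[ℝ] V →ₗ[ℝ] ℝ) (v : L2I T V) : ℝ :=
  √(opAs a v v)

/-- The norm of `∂ₜ u` in the dual `Y'` of `Y` with respect to the energy norm,
`‖∂ₜ u‖_{Y'} = sup_{0 ≠ v ∈ Y} (∂ₜ u)(v) / ‖v‖_Y` (a supremum of a bounded set). -/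
def dualNormDt (a : ℝ → V →ₗ[ℝ] V →ₗ[ℝ] ℝ) (u : spaceX T j) : ℝ :=
  ⨆ v : {v : L2I T V // v ≠ 0}, opDt u v.1 / normY a v.1

/-- The energy norm on `X`, `‖u‖_X² = ‖u‖_Y² + ‖∂ₜ u‖_{Y'}² + ‖u(T)‖²`. -/
def normX (a : ℝ → V →ₗ[ℝ] V →ₗ[ℝ] ℝ) (u : spaceX T j) : ℝ :=
  √(normY a (toY u) ^ 2 + dualNormDt a u ^ 2 + ‖trace T u‖ ^ 2)

/-! ### The inf-sup constant -/

open Classical in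
/-- `inf_{u ∈ X^δ, ∂ₜ u ≠ 0} sup_{0 ≠ v ∈ Y^δ} (∂ₜ u)(v) / (‖∂ₜ u‖_{Y'} ‖v‖_Y)` for a single pair
`(Y^δ, X^δ)`, to be read as `1` if `∂ₜ u = 0` for all `u ∈ X^δ`. -/
def infSup (a : ℝ → V →ₗ[ℝ] V →ₗ[ℝ] ℝ) (Yd : Submodule ℝ (L2I T V))
    (Xd : Submodule ℝ (spaceX T j)) : ℝ :=
  if ∃ u ∈ Xd, opDt u ≠ 0 then
    ⨅ u : {u : spaceX T j // u ∈ Xd ∧ opDt u ≠ 0},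
      ⨆ v : {v : L2I T V // v ∈ Yd ∧ v ≠ 0},
        opDt u.1 v.1 / (dualNormDt a u.1 * normY a v.1)
  else 1

/-- The constant `γ_Δ`, the infimum over `δ ∈ Δ` of the inf-sup constants of `(Y^δ, X^δ)`. -/
def gammaDelta {Δ : Type*} (a : ℝ → V →ₗ[ℝ] V →ₗ[ℝ] ℝ) (Yd : Δ → Submodule ℝ (L2I T V))
    (Xd : Δ → Submodule ℝ (spaceX T j)) : ℝ :=
  ⨅ δ : Δ, infSup a (Yd δ) (Xd δ)

/-! ### The exact problem and the Galerkin discretization -/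

/-- `u ∈ X` solves the space-time variational formulation
`(B u)(v₁) + ⟨u(0), v₂⟩ = g(v₁) + ⟨u₀, v₂⟩` for all `(v₁, v₂) ∈ Y × H`. -/
def IsSolution (a : ℝ → V →ₗ[ℝ] V →ₗ[ℝ] ℝ) (g : StrongDual ℝ (L2I T V)) (u₀ : H)
    (u : spaceX T j) : Prop :=
  ∀ (v₁ : L2I T V) (v₂ : H),
    opB a u v₁ + inner ℝ (trace 0 u) v₂ = g v₁ + inner ℝ u₀ v₂

/-- `(μ, σ, u) ∈ Y^δ × H^δ × X^δ` solves the Galerkin discretization of the saddle point system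
`A_s μ + B u = g`, `σ + γ₀ u = u₀`, `B' μ + γ₀' σ = 0`. -/
structure IsGalerkinSolution (a : ℝ → V →ₗ[ℝ] V →ₗ[ℝ] ℝ) (Yd : Submodule ℝ (L2I T V))
    (Hd : Submodule ℝ H) (Xd : Submodule ℝ (spaceX T j)) (g : StrongDual ℝ (L2I T V)) (u₀ : H)
    (μ : L2I T V) (σ : H) (u : spaceX T j) : Prop where
  mem_Y : μ ∈ Yd
  mem_H : σ ∈ Hd
  mem_X : u ∈ Xd
  eq_Y : ∀ v ∈ Yd, opAs a μ v + opB a u v = g v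
  eq_H : ∀ h ∈ Hd, inner ℝ σ h + inner ℝ (trace 0 u) h = inner ℝ u₀ h
  eq_X : ∀ w ∈ Xd, opB a w μ + inner ℝ (trace 0 w) σ = 0

end Spaces

end

end SpaceTime

/-!
Write `R` for the Riesz map `Y' → Y` of the energy inner product `A = A_s`, and `R_W` for `R` followed
by the orthogonal projection onto `W = Y^δ`. Elimination of `μ` and `σ` from the saddle point system
(`galerkin_iff`) leaves the normal equations on `X^δ` of the least-squares form
`b(w, z) = ⟨R_W B w, R_W B z⟩_Y + ⟨w(0), z(0)⟩`, here `residualForm`.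

Since `R A = 1` and `2 (∂ₜ u)(u) = ‖u(T)‖² - ‖u(0)‖²`, the cross term in `‖R B u‖² = ‖R ∂ₜ u + u‖²`
turns the initial trace into the final trace, so that `‖B u‖_{Y'}² + ‖u(0)‖² = ‖u‖_X²` and therefore
`b ≤ ‖·‖_X²`. The same computation for `R_W` is valid on `X^δ`, as `X^δ ⊆ Y^δ`, and gives
`b(w, w) = ‖R_W ∂ₜ w‖² + ‖w‖_Y² + ‖w(T)‖² ≥ γ² ‖w‖_X²`, because
`‖R ∂ₜ w‖` and `‖R_W ∂ₜ w‖` are the suprema in the inf-sup constant (`IsRieszMap.iSup_div_eq`), so that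
`γ ≤ 1` and `γ ‖R ∂ₜ w‖ ≤ ‖R_W ∂ₜ w‖`. Unique solvability follows by Lax–Milgram
(`existsUnique_normal_equations`). The error is `b`-orthogonal to `X^δ`, and the identity
`‖1 - P‖ = ‖P‖` for nontrivial projectors, in the form `sq_mul_apply_le_of_orthogonal`, gives
the constant `γ⁻¹`.

The analytic input is the embedding `X ↪ C([0, T]; H)` with its energy identity. The compact operator
`j* j` provides a basis that is orthogonal both in `V` and in `H`. Each coordinate of `u` is a scalar
function with an integrable weak derivative, hence absolutely continuous, and obeys the chain rule;
summation gives `‖u(b) - e‖² - ‖u(a) - e‖² = 2 ∫ₐᵇ ⟨u', u - e⟩` for almost all `a`, `b` and all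
`e ∈ V` (`exists_energy_identity`). With `e = u(a)` for a suitable time `a`, this bounds the oscillation
of `u` over an interval `J` by the norms of `u` in `L₂(J; V)` and of `u'` in `L₂(J; V')`
(`exists_norm_sub_sq_le`). Hence `u` extends continuously in `H` to all of `[0, T]`, with a bound by
its norm in `X`, and the energy identity extends with it.
-/

namespace SpaceTime

/-! ### Coercive symmetric forms on a Hilbert space -/

section Form

variable {Y : Type*} [NormedAddCommGroup Y] [InnerProductSpace ℝ Y]

theorem _root_.IsCoercive.apply_self_nonneg {s : Y →L[ℝ] Y →L[ℝ] ℝ} (hs : IsCoercive s) (v : Y) :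
    0 ≤ s v v := by
  obtain ⟨c, hc, h⟩ := hs
  exact le_trans (by positivity) (h v)

theorem _root_.IsCoercive.apply_self_pos {s : Y →L[ℝ] Y →L[ℝ] ℝ} (hs : IsCoercive s) {v : Y}
    (hv : v ≠ 0) : 0 < s v v := by
  obtain ⟨c, hc, h⟩ := hs
  have := norm_pos_iff.2 hv
  exact lt_of_lt_of_le (by positivity) (h v)

/-- Cauchy–Schwarz for positive semidefinite symmetric bilinear forms. -/
theorem sq_apply_le_of_nonneg {X : Type*} [NormedAddCommGroup X] [NormedSpace ℝ X]
    {e : X →L[ℝ] X →L[ℝ] ℝ} (hsymm : ∀ x y, e x y = e y x) (hpos : ∀ x, 0 ≤ e x x) (x y : X) :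
    e x y ^ 2 ≤ e x x * e y y := by
  have h : ∀ t : ℝ, 0 ≤ e y y * (t * t) + 2 * e x y * t + e x x := by
    intro t
    have := hpos (x + t • y)
    simp only [map_add, map_smul, add_apply, smul_apply, smul_eq_mul, hsymm y x] at this
    linarith
  have := discrim_le_zero h
  rw [discrim] at this
  nlinarith

/-- `R` represents functionals on the subspace `W` with respect to the form `s`: `R f ∈ W` and
`s (R f) v = f v` for all `v ∈ W`. For `W = Y` this is the Riesz map of the energy inner product
`s`; in general it is the Riesz map followed by the `s`-orthogonal projection onto `W`. -/
structure IsRieszMap (s : Y →L[ℝ] Y →L[ℝ] ℝ) (W : Submodule ℝ Y) (R : StrongDual ℝ Y →L[ℝ] Y) :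
    Prop where
  mem : ∀ f, R f ∈ W
  apply_eq : ∀ f, ∀ v ∈ W, s (R f) v = f v

theorem exists_isRieszMap [CompleteSpace Y] {s : Y →L[ℝ] Y →L[ℝ] ℝ} (hs : IsCoercive s)
    {W : Submodule ℝ Y} (hW : IsClosed (W : Set Y)) : ∃ R, IsRieszMap s W R := by
  have := hW.completeSpace_coe
  let sW : W →L[ℝ] W →L[ℝ] ℝ := s.bilinearComp W.subtypeL W.subtypeL
  have hsW : IsCoercive sW := by
    obtain ⟨c, hc, h⟩ := hs
    exact ⟨c, hc, fun v => h v⟩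
  have hex : ∀ f : StrongDual ℝ Y, ∃ r ∈ W, ∀ v ∈ W, s r v = f v := by
    intro f
    let r : W := hsW.continuousLinearEquivOfBilin.symm
      ((InnerProductSpace.toDual ℝ W).symm (f.comp W.subtypeL))
    refine ⟨r, r.2, fun v hv => ?_⟩
    have := hsW.continuousLinearEquivOfBilin_apply r ⟨v, hv⟩
    rw [ContinuousLinearEquiv.apply_symm_apply, InnerProductSpace.toDual_symm_apply] at this
    exact this.symm
  have huniq : ∀ r ∈ W, (∀ v ∈ W, s r v = 0) → r = 0 := by
    intro r hr h
    by_contra h0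
    exact (hs.apply_self_pos h0).ne' (h r hr)
  choose R hRW hR using hex
  obtain ⟨c, hc, hcoer⟩ := hs
  let L : StrongDual ℝ Y →ₗ[ℝ] Y :=
    { toFun := R
      map_add' := fun f g => by
        rw [← sub_eq_zero]
        refine huniq _ (W.sub_mem (hRW _) (W.add_mem (hRW _) (hRW _))) fun v hv => ?_
        simp [hR _ v hv]
      map_smul' := fun k f => by
        rw [← sub_eq_zero]
        refine huniq _ (W.sub_mem (hRW _) (W.smul_mem _ (hRW _))) fun v hv => ?_
        simp [hR _ v hv] }
  refine ⟨L.mkContinuous c⁻¹ fun f => ?_, ⟨hRW, hR⟩⟩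
  change ‖R f‖ ≤ c⁻¹ * ‖f‖
  rcases eq_or_lt_of_le (norm_nonneg (R f)) with h0 | h0
  · rw [← h0]; positivity
  rw [inv_mul_eq_div, le_div_iff₀ hc]
  refine le_of_mul_le_mul_right ?_ h0
  calc ‖R f‖ * c * ‖R f‖ = c * ‖R f‖ * ‖R f‖ := by ring
    _ ≤ s (R f) (R f) := hcoer _
    _ = f (R f) := hR f _ (hRW f)
    _ ≤ ‖f‖ * ‖R f‖ := (le_abs_self _).trans (f.le_opNorm _)

variable {s : Y →L[ℝ] Y →L[ℝ] ℝ} {W : Submodule ℝ Y} {R R' : StrongDual ℝ Y →L[ℝ] Y}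

/-- The dual norm of `f` over the subspace `W`, with respect to the energy norm, is the energy norm
of its Riesz representative. The index type `ι` enumerates the nonzero elements of `W`. -/
theorem IsRieszMap.iSup_div_eq (hs : IsCoercive s) (hsymm : ∀ u v, s u v = s v u)
    (hR : IsRieszMap s W R) {ι : Type*} (x : ι → Y) (hx : ∀ i, x i ∈ W ∧ x i ≠ 0)
    (hx' : ∀ v ∈ W, v ≠ 0 → ∃ i, x i = v) (f : StrongDual ℝ Y) :
    ⨆ i, f (x i) / √(s (x i) (x i)) = √(s (R f) (R f)) := by
  have hle : ∀ i, f (x i) / √(s (x i) (x i)) ≤ √(s (R f) (R f)) := by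
    intro i
    have hpos := hs.apply_self_pos (hx i).2
    rw [div_le_iff₀ (Real.sqrt_pos.2 hpos), ← hR.apply_eq f _ (hx i).1,
      ← Real.sqrt_mul (hs.apply_self_nonneg _)]
    exact Real.le_sqrt_of_sq_le (sq_apply_le_of_nonneg hsymm hs.apply_self_nonneg _ _)
  by_cases h0 : R f = 0
  · have hz : ∀ i, f (x i) / √(s (x i) (x i)) = 0 := by
      intro i
      rw [← hR.apply_eq f _ (hx i).1, h0]
      simp
    simp [hz, h0]
  · obtain ⟨i, hi⟩ := hx' _ (hR.mem f) h0
    have : Nonempty ι := ⟨i⟩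
    refine le_antisymm (ciSup_le hle) ?_
    refine le_trans (le_of_eq ?_) (le_ciSup (f := fun i => f (x i) / √(s (x i) (x i)))
      ⟨_, forall_mem_range.2 hle⟩ i)
    simp only [hi]
    rw [← hR.apply_eq f _ (hR.mem f), Real.div_sqrt]

theorem IsRieszMap.apply_le_apply (hs : IsCoercive s) (hsymm : ∀ u v, s u v = s v u)
    (hR : IsRieszMap s ⊤ R) (hR' : IsRieszMap s W R') (f : StrongDual ℝ Y) :
    s (R' f) (R' f) ≤ s (R f) (R f) := by
  have h := hs.apply_self_nonneg (R f - R' f)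
  have h1 := hR.apply_eq f (R' f) trivial
  have h2 := hR'.apply_eq f (R' f) (hR'.mem f)
  simp only [map_sub, sub_apply] at h
  rw [hsymm (R' f) (R f)] at h
  linarith

theorem IsRieszMap.map_apply (hs : IsCoercive s) (hR : IsRieszMap s W R) {v : Y} (hv : v ∈ W) :
    R (s v) = v := by
  rw [← sub_eq_zero]
  by_contra h0
  refine (hs.apply_self_pos h0).ne' ?_
  have := hR.apply_eq (s v) _ (W.sub_mem (hR.mem (s v)) hv)
  rw [map_sub s, sub_apply, this, sub_self]

end Form

/-- **Lax–Milgram** on a Banach space `E` that embeds into a Hilbert space `K`. -/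
theorem exists_forall_apply_eq_of_coercive {E K : Type*} [NormedAddCommGroup E] [NormedSpace ℝ E]
    [CompleteSpace E] [NormedAddCommGroup K] [InnerProductSpace ℝ K] [CompleteSpace K]
    (i : E →L[ℝ] K) {C : ℝ} (hi : ∀ x, ‖x‖ ≤ C * ‖i x‖) (b : E →L[ℝ] E →L[ℝ] ℝ) {c : ℝ}
    (hc : 0 < c) (hb : ∀ x, c * ‖i x‖ ^ 2 ≤ b x x) (F : StrongDual ℝ E) :
    ∃ x, ∀ w, b x w = F w := by
  have hanti : AntilipschitzWith C.toNNReal i := by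
    refine i.antilipschitz_of_bound fun x => (hi x).trans ?_
    exact mul_le_mul_of_nonneg_right (Real.le_coe_toNNReal C) (norm_nonneg _)
  have hclosed : IsClosed (range i) := hanti.isClosed_range i.uniformContinuous
  let e := i.equivRange hanti.injective hclosed
  have : CompleteSpace i.range := hclosed.completeSpace_coe
  let b' : i.range →L[ℝ] i.range →L[ℝ] ℝ :=
    b.bilinearComp (e.symm : i.range →L[ℝ] E) (e.symm : i.range →L[ℝ] E)
  have hb' : IsCoercive b' := by
    refine ⟨c, hc, fun y => ?_⟩
    obtain ⟨x, rfl⟩ := e.surjective y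
    have := hb x
    simp only [b', ContinuousLinearMap.bilinearComp_apply, ContinuousLinearEquiv.coe_coe,
      ContinuousLinearEquiv.symm_apply_apply]
    calc c * ‖e x‖ * ‖e x‖ = c * ‖i x‖ ^ 2 := by
          rw [show ‖e x‖ = ‖i x‖ from rfl]; ring
      _ ≤ b x x := this
  let y := hb'.continuousLinearEquivOfBilin.symm
    ((InnerProductSpace.toDual ℝ i.range).symm (F.comp (e.symm : i.range →L[ℝ] E)))
  refine ⟨e.symm y, fun w => ?_⟩
  have := hb'.continuousLinearEquivOfBilin_apply y (e w)
  rw [ContinuousLinearEquiv.apply_symm_apply, InnerProductSpace.toDual_symm_apply] at this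
  simpa [b'] using this.symm

/-- Let `e` and `b` be positive semidefinite symmetric forms with `b ≤ e`, and let `p` and `q` be
`b`-orthogonal. If `γ² e(p, p) ≤ b(p, p)` with `γ ≤ 1`, then `γ² e(q, q) ≤ e(p + q, p + q)`. This is
the estimate `‖1 - P‖ ≤ ‖P‖` for a nonzero projector `P` on a Hilbert space, which is what makes the
quasi-optimality constant `γ⁻¹` rather than `1 + γ⁻¹`. -/
theorem sq_mul_apply_le_of_orthogonal {X : Type*} [NormedAddCommGroup X] [NormedSpace ℝ X]
    {e b : X →L[ℝ] X →L[ℝ] ℝ} (he : ∀ x y, e x y = e y x) (hb : ∀ x y, b x y = b y x)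
    (hb0 : ∀ x, 0 ≤ b x x) (hbe : ∀ x, b x x ≤ e x x) {γ : ℝ} (hγ0 : 0 ≤ γ) (hγ : γ ≤ 1) {p q : X}
    (hp : γ ^ 2 * e p p ≤ b p p) (hpq : b p q = 0) :
    γ ^ 2 * e q q ≤ e (p + q) (p + q) := by
  have he0 : ∀ x, 0 ≤ e x x := fun x => (hb0 x).trans (hbe x)
  have hcs := sq_apply_le_of_nonneg he he0 p q
  have hexp : e (p + q) (p + q) = e p p + 2 * e p q + e q q := by
    simp only [map_add, add_apply, he q p]
    ring
  have hγ2 : γ ^ 2 ≤ 1 := pow_le_one₀ hγ0 hγ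
  rw [hexp]
  rcases (he0 p).eq_or_lt with hP | hP
  · have : e p q = 0 := by
      rw [← hP, zero_mul] at hcs
      exact pow_eq_zero_iff two_ne_zero |>.1 (le_antisymm hcs (sq_nonneg _))
    rw [this, ← hP]
    nlinarith [he0 q]
  rcases (he0 q).eq_or_lt with hQ | hQ
  · have : e p q = 0 := by
      rw [← hQ, mul_zero] at hcs
      exact pow_eq_zero_iff two_ne_zero |>.1 (le_antisymm hcs (sq_nonneg _))
    rw [this, ← hQ]
    linarith
  -- Exchange the lengths of `p` and `q`: this keeps `e (p + q) (p + q)`.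
  set α := √(e q q / e p p)
  have hα : 0 < α := Real.sqrt_pos.2 (div_pos hQ hP)
  have hα2 : α ^ 2 = e q q / e p p := Real.sq_sqrt (div_pos hQ hP).le
  have h1 := hbe (α • p + α⁻¹ • q)
  have h2 := hb0 (α⁻¹ • q)
  simp only [map_add, map_smul, add_apply, smul_apply, smul_eq_mul, he q p, hb q p, hpq,
    mul_zero, add_zero, zero_add] at h1 h2
  have h3 : α * (α * e p p) = e q q := by
    rw [← mul_assoc, ← sq, hα2, div_mul_cancel₀ _ hP.ne']
  have h4 : α⁻¹ * (α⁻¹ * e q q) = e p p := by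
    rw [← h3]; field_simp
  have h5 : α * (α⁻¹ * e p q) = e p q := by field_simp
  have h6 : α⁻¹ * (α * e p q) = e p q := by field_simp
  have h7 : γ ^ 2 * e q q ≤ α * (α * b p p) := by
    calc γ ^ 2 * e q q = α ^ 2 * (γ ^ 2 * e p p) := by rw [← h3]; ring
      _ ≤ α ^ 2 * b p p := by gcongr
      _ = _ := by ring
  linarith

/-! ### The Galerkin method for an abstract parabolic operator -/

section Galerkin

variable {X Y H : Type*} [NormedAddCommGroup X] [NormedSpace ℝ X]
  [NormedAddCommGroup Y] [InnerProductSpace ℝ Y]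
  [NormedAddCommGroup H] [InnerProductSpace ℝ H]

/-- The abstract parabolic operator `B = D + A : X → Y'`, where `D` stands for the time derivative,
`A` for the operator induced by the form `s`, and `ι` for the embedding of `X` into `Y`. -/
noncomputable def parabolicOp (s : Y →L[ℝ] Y →L[ℝ] ℝ) (D : X →L[ℝ] StrongDual ℝ Y) (ι : X →L[ℝ] Y) :
    X →L[ℝ] StrongDual ℝ Y :=
  D + s ∘L ι

/-- The inner product on `X` that induces the energy norm: `R` is the Riesz map of `Y`, and `τT` the
trace at the final time. -/
noncomputable def energyForm (s : Y →L[ℝ] Y →L[ℝ] ℝ) (D : X →L[ℝ] StrongDual ℝ Y) (ι : X →L[ℝ] Y)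
    (R : StrongDual ℝ Y →L[ℝ] Y) (τT : X →L[ℝ] H) : X →L[ℝ] X →L[ℝ] ℝ :=
  s.bilinearComp ι ι + s.bilinearComp (R ∘L D) (R ∘L D) +
    ((innerSL ℝ : H →L[ℝ] H →L[ℝ] ℝ).bilinearComp τT τT : X →L[ℝ] X →L[ℝ] ℝ)

/-- The least-squares form `(x, y) ↦ ⟨B x, B y⟩ + ⟨x(0), y(0)⟩` of the parabolic problem, where the
first product is that of the dual of the subspace `W` on which `R` is a Riesz map, and `τ0` is the
trace at the initial time. The Galerkin solution is a Galerkin approximation for this form. -/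
noncomputable def residualForm (s : Y →L[ℝ] Y →L[ℝ] ℝ) (D : X →L[ℝ] StrongDual ℝ Y) (ι : X →L[ℝ] Y)
    (R : StrongDual ℝ Y →L[ℝ] Y) (τ0 : X →L[ℝ] H) : X →L[ℝ] X →L[ℝ] ℝ :=
  s.bilinearComp (R ∘L parabolicOp s D ι) (R ∘L parabolicOp s D ι) +
    ((innerSL ℝ : H →L[ℝ] H →L[ℝ] ℝ).bilinearComp τ0 τ0 : X →L[ℝ] X →L[ℝ] ℝ)

variable {s : Y →L[ℝ] Y →L[ℝ] ℝ} {D : X →L[ℝ] StrongDual ℝ Y} {ι : X →L[ℝ] Y}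
  {R R' : StrongDual ℝ Y →L[ℝ] Y} {τ0 τT : X →L[ℝ] H} {W : Submodule ℝ Y}

theorem parabolicOp_apply (x : X) (v : Y) : parabolicOp s D ι x v = D x v + s (ι x) v := rfl

theorem energyForm_apply (x y : X) : energyForm s D ι R τT x y =
    s (ι x) (ι y) + s (R (D x)) (R (D y)) + inner ℝ (τT x) (τT y) := rfl

theorem residualForm_apply (x y : X) : residualForm s D ι R τ0 x y =
    s (R (parabolicOp s D ι x)) (R (parabolicOp s D ι y)) + inner ℝ (τ0 x) (τ0 y) := rfl

theorem energyForm_comm (hsymm : ∀ u v, s u v = s v u) (x y : X) :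
    energyForm s D ι R τT x y = energyForm s D ι R τT y x := by
  simp only [energyForm_apply, hsymm (ι x), hsymm (R (D x)), real_inner_comm (τT x)]

theorem residualForm_comm (hsymm : ∀ u v, s u v = s v u) (x y : X) :
    residualForm s D ι R τ0 x y = residualForm s D ι R τ0 y x := by
  simp only [residualForm_apply, hsymm (R (parabolicOp s D ι x)), real_inner_comm (τ0 x)]

theorem residualForm_self_nonneg (hs : IsCoercive s) (x : X) :
    0 ≤ residualForm s D ι R τ0 x x :=
  add_nonneg (hs.apply_self_nonneg _) real_inner_self_nonneg

/-- The cross term `2 (D x)(x)` in `‖D x + A x‖²` turns the initial trace into the final trace. This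
needs `x ∈ W`, which is why trial functions have to be test functions. -/
theorem residualForm_self_eq (hs : IsCoercive s) (hsymm : ∀ u v, s u v = s v u)
    (henergy : ∀ x, 2 * D x (ι x) = ‖τT x‖ ^ 2 - ‖τ0 x‖ ^ 2)
    (hR : IsRieszMap s W R) {x : X} (hx : ι x ∈ W) :
    residualForm s D ι R τ0 x x = s (ι x) (ι x) + s (R (D x)) (R (D x)) + ‖τT x‖ ^ 2 := by
  have h1 : R (parabolicOp s D ι x) = R (D x) + ι x := by
    change R (D x + s (ι x)) = _
    rw [map_add, hR.map_apply hs hx]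
  have h2 := hR.apply_eq (D x) (ι x) hx
  have h3 := henergy x
  rw [residualForm_apply, h1, real_inner_self_eq_norm_sq]
  simp only [map_add, add_apply, hsymm (ι x) (R (D x)), h2]
  linarith

theorem residualForm_self_le_energyForm (hs : IsCoercive s) (hsymm : ∀ u v, s u v = s v u)
    (henergy : ∀ x, 2 * D x (ι x) = ‖τT x‖ ^ 2 - ‖τ0 x‖ ^ 2)
    (hR : IsRieszMap s ⊤ R) (hR' : IsRieszMap s W R') (x : X) :
    residualForm s D ι R' τ0 x x ≤ energyForm s D ι R τT x x := by
  have h1 := residualForm_self_eq hs hsymm henergy hR (x := x) trivial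
  have h2 := hR.apply_le_apply hs hsymm hR' (parabolicOp s D ι x)
  rw [energyForm_apply, real_inner_self_eq_norm_sq, ← h1, residualForm_apply, residualForm_apply]
  linarith

/-- Coercivity of the discrete least-squares form in the energy norm. -/
theorem sq_mul_energyForm_le_residualForm (hs : IsCoercive s) (hsymm : ∀ u v, s u v = s v u)
    (henergy : ∀ x, 2 * D x (ι x) = ‖τT x‖ ^ 2 - ‖τ0 x‖ ^ 2)
    (hR' : IsRieszMap s W R') {γ : ℝ} (hγ0 : 0 ≤ γ) (hγ1 : γ ≤ 1) {x : X} (hx : ι x ∈ W)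
    (hγ : γ ^ 2 * s (R (D x)) (R (D x)) ≤ s (R' (D x)) (R' (D x))) :
    γ ^ 2 * energyForm s D ι R τT x x ≤ residualForm s D ι R' τ0 x x := by
  have hγ2 : γ ^ 2 ≤ 1 := pow_le_one₀ hγ0 hγ1
  rw [residualForm_self_eq hs hsymm henergy hR' hx, energyForm_apply, real_inner_self_eq_norm_sq]
  nlinarith [hs.apply_self_nonneg (ι x), sq_nonneg ‖τT x‖]

/-- Elimination of `μ` and `σ` from the saddle point system leaves the normal equations of the
least-squares form. -/
theorem galerkin_iff {Hd : Submodule ℝ H} [Hd.HasOrthogonalProjection] {Xd : Submodule ℝ X}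
    (hs : IsCoercive s) (hR : IsRieszMap s W R)
    (hXH : ∀ w ∈ Xd, τ0 w ∈ Hd) (g : StrongDual ℝ Y) (u₀ : H) (μ : Y) (σ : H) (u : X) :
    (μ ∈ W ∧ σ ∈ Hd ∧ (∀ v ∈ W, s μ v + parabolicOp s D ι u v = g v) ∧
      (∀ h ∈ Hd, inner ℝ σ h + inner ℝ (τ0 u) h = inner ℝ u₀ h) ∧
      ∀ w ∈ Xd, parabolicOp s D ι w μ + inner ℝ (τ0 w) σ = 0) ↔
    μ = R (g - parabolicOp s D ι u) ∧ σ = Hd.starProjection (u₀ - τ0 u) ∧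
      ∀ w ∈ Xd, residualForm s D ι R τ0 w u =
        s (R (parabolicOp s D ι w)) (R g) + inner ℝ (τ0 w) u₀ := by
  have key : ∀ w ∈ Xd, parabolicOp s D ι w (R (g - parabolicOp s D ι u)) +
      inner ℝ (τ0 w) (Hd.starProjection (u₀ - τ0 u)) =
      s (R (parabolicOp s D ι w)) (R g) + inner ℝ (τ0 w) u₀ - residualForm s D ι R τ0 w u := by
    intro w hw
    rw [← hR.apply_eq _ _ (hR.mem (g - parabolicOp s D ι u)), residualForm_apply,
      ← Submodule.inner_starProjection_left_eq_right,
      Submodule.starProjection_eq_self_iff.2 (hXH w hw), map_sub R, map_sub, inner_sub_right]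
    ring
  constructor
  · rintro ⟨hμ, hσ, h1, h2, h3⟩
    have eμ : μ = R (g - parabolicOp s D ι u) := by
      rw [← hR.map_apply hs hμ, ← sub_eq_zero, ← map_sub]
      by_contra h0
      refine (hs.apply_self_pos h0).ne' ?_
      rw [hR.apply_eq _ _ (hR.mem _)]
      have := h1 _ (hR.mem (s μ - (g - parabolicOp s D ι u)))
      simp only [sub_apply]
      linarith
    have eσ : σ = Hd.starProjection (u₀ - τ0 u) := by
      refine (Submodule.eq_starProjection_of_mem_of_inner_eq_zero hσ fun h hh => ?_).symm
      rw [inner_sub_left, inner_sub_left]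
      have := h2 h hh
      linarith
    refine ⟨eμ, eσ, fun w hw => ?_⟩
    have h4 := h3 w hw
    rw [eμ, eσ, key w hw] at h4
    linarith
  · rintro ⟨rfl, rfl, h⟩
    refine ⟨hR.mem _, Submodule.starProjection_apply_mem _ _, fun v hv => ?_, fun h hh => ?_,
      fun w hw => ?_⟩
    · rw [hR.apply_eq _ _ hv, sub_apply]
      ring
    · rw [Submodule.inner_starProjection_left_eq_right, Submodule.starProjection_eq_self_iff.2 hh,
        inner_sub_left]
      ring
    · rw [key w hw, h w hw, sub_self]

/-- The normal equations on a closed subspace `Xd` are uniquely solvable. -/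
theorem existsUnique_normal_equations [CompleteSpace X] [CompleteSpace Y]
    {Xd : Submodule ℝ X} (hXd : IsClosed (Xd : Set X))
    (hs : IsCoercive s) (hsymm : ∀ u v, s u v = s v u)
    (henergy : ∀ x, 2 * D x (ι x) = ‖τT x‖ ^ 2 - ‖τ0 x‖ ^ 2)
    (hnorm : ∀ x, ‖x‖ ≤ ‖ι x‖ + ‖D x‖)
    (hR : IsRieszMap s ⊤ R) (hR' : IsRieszMap s W R') (hXW : ∀ w ∈ Xd, ι w ∈ W)
    {γ : ℝ} (hγ0 : 0 < γ) (hγ1 : γ ≤ 1)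
    (hγ : ∀ w ∈ Xd, γ ^ 2 * s (R (D w)) (R (D w)) ≤ s (R' (D w)) (R' (D w)))
    (F : StrongDual ℝ X) :
    ∃! u, u ∈ Xd ∧ ∀ w ∈ Xd, residualForm s D ι R' τ0 w u = F w := by
  have := hXd.completeSpace_coe
  obtain ⟨c, hc, hcoer⟩ := id hs
  let i : Xd →L[ℝ] WithLp 2 (Y × Y) :=
    (WithLp.prodContinuousLinearEquiv 2 ℝ Y Y).symm.toContinuousLinearMap ∘L
      (ι.prod (R ∘L D)) ∘L Xd.subtypeL
  have hi : ∀ x : Xd, ‖i x‖ ^ 2 = ‖ι x‖ ^ 2 + ‖R (D x)‖ ^ 2 := fun x =>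
    WithLp.prod_norm_sq_eq_of_L2 _
  have hD : ∀ x, ‖D x‖ ≤ ‖s‖ * ‖R (D x)‖ := by
    intro x
    have : D x = s (R (D x)) := by
      ext v
      exact (hR.apply_eq _ _ trivial).symm
    calc ‖D x‖ = ‖s (R (D x))‖ := by rw [← this]
      _ ≤ _ := s.le_opNorm _
  have hbelow : ∀ x : Xd, γ ^ 2 * c * ‖i x‖ ^ 2 ≤ residualForm s D ι R' τ0 x x := by
    intro x
    refine le_trans ?_ (sq_mul_energyForm_le_residualForm (R := R) hs hsymm henergy hR' hγ0.le hγ1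
      (hXW x x.2) (hγ x x.2))
    rw [energyForm_apply, real_inner_self_eq_norm_sq, hi, mul_assoc]
    have h1 := hcoer (ι x)
    have h2 := hcoer (R (D x))
    refine mul_le_mul_of_nonneg_left ?_ (sq_nonneg γ)
    nlinarith [sq_nonneg ‖τT (x : X)‖]
  have hanti : ∀ x : Xd, ‖x‖ ≤ (1 + ‖s‖) * ‖i x‖ := by
    intro x
    have h1 : ‖ι x‖ ≤ ‖i x‖ :=
      (pow_le_pow_iff_left₀ (norm_nonneg _) (norm_nonneg _) two_ne_zero).1
        (by rw [hi]; nlinarith [sq_nonneg ‖R (D x)‖])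
    have h2 : ‖R (D x)‖ ≤ ‖i x‖ :=
      (pow_le_pow_iff_left₀ (norm_nonneg _) (norm_nonneg _) two_ne_zero).1
        (by rw [hi]; nlinarith [sq_nonneg ‖ι x‖])
    calc ‖x‖ ≤ ‖ι x‖ + ‖D x‖ := hnorm x
      _ ≤ ‖i x‖ + ‖s‖ * ‖i x‖ := add_le_add h1 ((hD x).trans (by gcongr))
      _ = _ := by ring
  have hpos : 0 < γ ^ 2 * c := by positivity
  obtain ⟨u, hu⟩ := exists_forall_apply_eq_of_coercive i hanti
    ((residualForm s D ι R' τ0).bilinearComp Xd.subtypeL Xd.subtypeL) hpos hbelow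
    (F.comp Xd.subtypeL)
  -- The functional tests in the second argument; the form is symmetric.
  refine ⟨u, ⟨u.2, fun w hw => ?_⟩, ?_⟩
  · rw [residualForm_comm hsymm]
    exact hu ⟨w, hw⟩
  · rintro y ⟨hy, hy'⟩
    have hd : residualForm s D ι R' τ0 (y - u) (y - u) = 0 := by
      have hm : y - u ∈ Xd := Xd.sub_mem hy u.2
      rw [map_sub _ y (u : X), hy' _ hm, residualForm_comm hsymm]
      have := hu ⟨_, hm⟩
      simp only [ContinuousLinearMap.bilinearComp_apply, Submodule.subtypeL_apply,
        ContinuousLinearMap.comp_apply] at this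
      rw [this, sub_self]
    have h1 := hbelow ⟨y - u, Xd.sub_mem hy u.2⟩
    rw [show residualForm s D ι R' τ0 _ _ = 0 from hd] at h1
    have h2 := hanti ⟨y - u, Xd.sub_mem hy u.2⟩
    have h3 : ‖i ⟨y - u, Xd.sub_mem hy u.2⟩‖ = 0 := by
      by_contra h0
      have : 0 < ‖i ⟨y - u, Xd.sub_mem hy u.2⟩‖ := lt_of_le_of_ne (norm_nonneg _) (Ne.symm h0)
      have := mul_pos hpos (pow_pos this 2)
      linarith
    rw [h3, mul_zero] at h2
    exact sub_eq_zero.1 (norm_le_zero_iff.1 h2)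

/-- Quasi-optimality of the solution `ud` of the normal equations, for an exact solution `u`. -/
theorem sq_mul_energyForm_sub_le {Xd : Submodule ℝ X}
    (hs : IsCoercive s) (hsymm : ∀ u v, s u v = s v u)
    (henergy : ∀ x, 2 * D x (ι x) = ‖τT x‖ ^ 2 - ‖τ0 x‖ ^ 2)
    (hR : IsRieszMap s ⊤ R) (hR' : IsRieszMap s W R') (hXW : ∀ w ∈ Xd, ι w ∈ W)
    {γ : ℝ} (hγ0 : 0 < γ) (hγ1 : γ ≤ 1)
    (hγ : ∀ w ∈ Xd, γ ^ 2 * s (R (D w)) (R (D w)) ≤ s (R' (D w)) (R' (D w)))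
    {u ud w : X} (hud : ud ∈ Xd) (hw : w ∈ Xd)
    (h : ∀ x ∈ Xd, residualForm s D ι R' τ0 x ud =
      s (R' (parabolicOp s D ι x)) (R' (parabolicOp s D ι u)) + inner ℝ (τ0 x) (τ0 u)) :
    γ ^ 2 * energyForm s D ι R τT (u - ud) (u - ud) ≤ energyForm s D ι R τT (u - w) (u - w) := by
  have hp := Xd.sub_mem hud hw
  have := sq_mul_apply_le_of_orthogonal (e := energyForm s D ι R τT)
    (b := residualForm s D ι R' τ0) (p := ud - w) (q := u - ud) (energyForm_comm hsymm)
    (residualForm_comm hsymm) (residualForm_self_nonneg hs)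
    (residualForm_self_le_energyForm hs hsymm henergy hR hR') hγ0.le hγ1
    (sq_mul_energyForm_le_residualForm hs hsymm henergy hR' hγ0.le hγ1 (hXW _ hp) (hγ _ hp))
    (by rw [map_sub _ u ud, h _ hp, residualForm_apply, sub_self])
  rwa [show ud - w + (u - ud) = u - w by abel] at this

end Galerkin

/-! ### Bounded bilinear forms on Bochner spaces -/

section Bochner

open scoped ENNReal

theorem integral_norm_mul_norm_le {α E F : Type*} [MeasurableSpace α] [NormedAddCommGroup E]
    [NormedAddCommGroup F] {μ : Measure α} {f : α → E} {g : α → F} (hf : MemLp f 2 μ)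
    (hg : MemLp g 2 μ) :
    ∫ t, ‖f t‖ * ‖g t‖ ∂μ ≤ √(∫ t, ‖f t‖ ^ 2 ∂μ) * √(∫ t, ‖g t‖ ^ 2 ∂μ) := by
  have h := integral_mul_le_Lp_mul_Lq_of_nonneg (μ := μ) (p := 2) (q := 2)
    Real.HolderConjugate.two_two (f := fun t => ‖f t‖) (g := fun t => ‖g t‖)
    (Filter.Eventually.of_forall fun _ => norm_nonneg _)
    (Filter.Eventually.of_forall fun _ => norm_nonneg _)
    (by simpa using hf.norm) (by simpa using hg.norm)
  simpa [Real.sqrt_eq_rpow] using h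

theorem norm_sq_Lp_two {α E : Type*} [MeasurableSpace α] [NormedAddCommGroup E] {μ : Measure α}
    (f : Lp E 2 μ) : ‖f‖ ^ 2 = ∫ t, ‖f t‖ ^ 2 ∂μ := by
  have h0 : 0 ≤ ∫ t, ‖f t‖ ^ 2 ∂μ := integral_nonneg fun _ => by positivity
  rw [Lp.norm_def, (Lp.memLp f).eLpNorm_eq_integral_rpow_norm (by norm_num) (by norm_num)]
  simp only [ENNReal.toReal_ofNat, Real.rpow_ofNat]
  rw [ENNReal.toReal_ofReal (by positivity), ← Real.rpow_natCast, ← Real.rpow_mul h0]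
  norm_num

/-- Composition with a Carathéodory function preserves measurability. -/
theorem aemeasurable_comp_of_continuous {α E : Type*} [MeasurableSpace α] [TopologicalSpace E]
    {μ : Measure α} {F : α → E → ℝ} (hc : ∀ᵐ t ∂μ, Continuous (F t))
    (hm : ∀ x, AEMeasurable (fun t => F t x) μ) {u : α → E} (hu : AEStronglyMeasurable u μ) :
    AEMeasurable (fun t => F t (u t)) μ := by
  have hsimple : ∀ f : SimpleFunc α E, AEMeasurable (fun t => F t (f t)) μ := by
    intro f
    have hU : (⋃ x : f.range, f ⁻¹' {(x : E)}) = univ := by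
      ext t
      simp
    rw [← Measure.restrict_univ (μ := μ), ← hU, aemeasurable_iUnion_iff]
    intro x
    refine (hm x).restrict.congr ?_
    filter_upwards [ae_restrict_mem (f.measurableSet_fiber x)] with t ht
    rw [show f t = x from ht]
  refine aemeasurable_of_tendsto_metrizable_ae Filter.atTop
    (fun n => hsimple (hu.stronglyMeasurable_mk.approx n)) ?_
  filter_upwards [hc, hu.ae_eq_mk] with t ht hut
  rw [hut]
  exact (ht.tendsto _).comp (hu.stronglyMeasurable_mk.tendsto_approx t)

variable {V : Type*} [NormedAddCommGroup V] [InnerProductSpace ℝ V] {T : ℝ}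
  {a : ℝ → V →ₗ[ℝ] V →ₗ[ℝ] ℝ}

theorem integrable_form
    (ha_meas : ∀ η ζ : V, AEMeasurable (fun t => a t η ζ) (timeMeasure T)) {M : ℝ}
    (ha : ∀ᵐ t ∂(timeMeasure T), ∀ η ζ : V, |a t η ζ| ≤ M * ‖η‖ * ‖ζ‖) (u v : L2I T V) :
    Integrable (fun t => a t (u t) (v t)) (timeMeasure T) := by
  have hm : AEMeasurable (fun t => a t (u t) (v t)) (timeMeasure T) := by
    refine aemeasurable_comp_of_continuous (F := fun t (p : V × V) => a t p.1 p.2)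
      (u := fun t => (u t, v t)) ?_ (fun p => ha_meas _ _)
      ((Lp.aestronglyMeasurable u).prodMk (Lp.aestronglyMeasurable v))
    filter_upwards [ha] with t ht
    exact ((a t).mkContinuous₂ M ht).continuous₂
  refine Integrable.mono' (((Lp.memLp u).norm.integrable_mul (Lp.memLp v).norm).const_mul M)
    hm.aestronglyMeasurable ?_
  filter_upwards [ha] with t ht
  refine (ht _ _).trans (le_of_eq ?_)
  simp only [Pi.mul_apply]
  ring

theorem integrable_pairing (f : L2I T (StrongDual ℝ V)) (v : L2I T V) :
    Integrable (fun t => f t (v t)) (timeMeasure T) :=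
  memLp_one_iff_integrable.1 <|
    (ContinuousLinearMap.id ℝ (StrongDual ℝ V)).memLp_of_bilin 1 (Lp.memLp f) (Lp.memLp v)

/-- The operator `A : Y → Y'` is given by a bounded, coercive bilinear form. -/
theorem exists_continuous_bilin_eq_opA
    (ha_meas : ∀ η ζ : V, AEMeasurable (fun t => a t η ζ) (timeMeasure T))
    (ha_bdd : ∃ M : ℝ, ∀ᵐ t ∂(timeMeasure T), ∀ η ζ : V, |a t η ζ| ≤ M * ‖η‖ * ‖ζ‖)
    (ha_coer : ∃ c : ℝ, 0 < c ∧ ∀ᵐ t ∂(timeMeasure T), ∀ η : V, c * ‖η‖ ^ 2 ≤ a t η η) :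
    ∃ s : L2I T V →L[ℝ] L2I T V →L[ℝ] ℝ, IsCoercive s ∧ ∀ u v, s u v = opA a u v := by
  obtain ⟨M, hM⟩ := ha_bdd
  obtain ⟨c, hc, hcoer⟩ := ha_coer
  have hint := integrable_form ha_meas hM
  let s₀ : L2I T V →ₗ[ℝ] L2I T V →ₗ[ℝ] ℝ := LinearMap.mk₂ ℝ (opA a)
    (fun u u' v => by
      rw [opA, opA, opA, ← integral_add (hint _ _) (hint _ _)]
      refine integral_congr_ae ?_
      filter_upwards [Lp.coeFn_add u u'] with t ht
      rw [ht, Pi.add_apply, map_add]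
      rfl)
    (fun k u v => by
      rw [opA, opA, smul_eq_mul, ← integral_const_mul]
      refine integral_congr_ae ?_
      filter_upwards [Lp.coeFn_smul k u] with t ht
      rw [ht, Pi.smul_apply, map_smul]
      rfl)
    (fun u v v' => by
      rw [opA, opA, opA, ← integral_add (hint _ _) (hint _ _)]
      refine integral_congr_ae ?_
      filter_upwards [Lp.coeFn_add v v'] with t ht
      rw [ht, Pi.add_apply, map_add])
    (fun k u v => by
      rw [opA, opA, smul_eq_mul, ← integral_const_mul]
      refine integral_congr_ae ?_
      filter_upwards [Lp.coeFn_smul k v] with t ht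
      rw [ht, Pi.smul_apply, map_smul, smul_eq_mul])
  have hbound : ∀ u v, ‖s₀ u v‖ ≤ |M| * ‖u‖ * ‖v‖ := by
    intro u v
    have h1 := integral_norm_mul_norm_le (Lp.memLp u) (Lp.memLp v)
    rw [← norm_sq_Lp_two, ← norm_sq_Lp_two, Real.sqrt_sq (norm_nonneg _),
      Real.sqrt_sq (norm_nonneg _)] at h1
    have h2 : Integrable (fun t => ‖u t‖ * ‖v t‖) (timeMeasure T) :=
      (Lp.memLp u).norm.integrable_mul (Lp.memLp v).norm
    calc ‖s₀ u v‖ ≤ ∫ t, |M| * (‖u t‖ * ‖v t‖) ∂(timeMeasure T) := by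
          refine norm_integral_le_of_norm_le (h2.const_mul _) ?_
          filter_upwards [hM] with t ht
          refine (ht _ _).trans ?_
          rw [mul_assoc]
          exact mul_le_mul_of_nonneg_right (le_abs_self M) (by positivity)
      _ = |M| * ∫ t, ‖u t‖ * ‖v t‖ ∂(timeMeasure T) := integral_const_mul _ _
      _ ≤ |M| * (‖u‖ * ‖v‖) := by gcongr
      _ = _ := by ring
  refine ⟨s₀.mkContinuous₂ |M| hbound, ⟨c, hc, fun u => ?_⟩, fun u v => rfl⟩
  change c * ‖u‖ * ‖u‖ ≤ opA a u u
  rw [mul_assoc, ← sq, norm_sq_Lp_two, ← integral_const_mul]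
  refine integral_mono_ae ((Lp.memLp u).integrable_norm_pow two_ne_zero |>.const_mul c)
    (hint u u) ?_
  filter_upwards [hcoer] with t ht
  exact ht _

/-- The pairing of `L₂(I; V')` with `L₂(I; V)`. -/
noncomputable def dualPairing (T : ℝ) (V : Type*) [NormedAddCommGroup V] [InnerProductSpace ℝ V] :
    L2I T (StrongDual ℝ V) →L[ℝ] StrongDual ℝ (L2I T V) :=
  (ContinuousLinearMap.id ℝ (StrongDual ℝ V)).lpPairing (timeMeasure T) 2 2

theorem dualPairing_apply (f : L2I T (StrongDual ℝ V)) (v : L2I T V) :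
    dualPairing T V f v = ∫ t in Ioo 0 T, f t (v t) :=
  ContinuousLinearMap.lpPairing_eq_integral _ f v

/-- `L₂(I; V')` is isometrically embedded in the dual of `L₂(I; V)`: test with the pointwise Riesz
representative. -/
theorem norm_le_norm_dualPairing [CompleteSpace V] (f : L2I T (StrongDual ℝ V)) :
    ‖f‖ ≤ ‖dualPairing T V f‖ := by
  have hv : MemLp (fun t => (InnerProductSpace.toDual ℝ V).symm (f t)) 2 (timeMeasure T) :=
    (Lp.memLp f).congr_norm ((InnerProductSpace.toDual ℝ V).symm.continuous.comp_aestronglyMeasurable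
      (Lp.aestronglyMeasurable f)) (Filter.Eventually.of_forall fun t => by simp)
  have h1 : dualPairing T V f hv.toLp = ‖f‖ ^ 2 := by
    rw [dualPairing_apply, norm_sq_Lp_two]
    refine integral_congr_ae ?_
    filter_upwards [hv.coeFn_toLp] with t ht
    rw [ht, ← InnerProductSpace.toDual_symm_apply, real_inner_self_eq_norm_sq,
      LinearIsometryEquiv.norm_map]
  have h2 : ‖hv.toLp‖ = ‖f‖ := by
    rw [Lp.norm_toLp, Lp.norm_def]
    congr 1
    exact eLpNorm_congr_norm_ae (Filter.Eventually.of_forall fun t => by simp)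
  rcases eq_or_lt_of_le (norm_nonneg f) with h0 | h0
  · rw [← h0]
    positivity
  refine le_of_mul_le_mul_right ?_ h0
  calc ‖f‖ * ‖f‖ = dualPairing T V f hv.toLp := by rw [h1, sq]
    _ ≤ ‖dualPairing T V f‖ * ‖hv.toLp‖ :=
      (le_abs_self _).trans ((dualPairing T V f).le_opNorm _)
    _ = _ := by rw [h2]

variable {H : Type*} [NormedAddCommGroup H] [InnerProductSpace ℝ H] {j : V →L[ℝ] H}

theorem opB_eq_add (ha_meas : ∀ η ζ : V, AEMeasurable (fun t => a t η ζ) (timeMeasure T))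
    (ha_bdd : ∃ M : ℝ, ∀ᵐ t ∂(timeMeasure T), ∀ η ζ : V, |a t η ζ| ≤ M * ‖η‖ * ‖ζ‖)
    (w : spaceX T j) (v : L2I T V) : opB a w v = opDt w v + opA a (toY w) v := by
  obtain ⟨M, hM⟩ := ha_bdd
  exact integral_add (integrable_pairing _ _) (integrable_form ha_meas hM _ _)

/-- The weak derivative may be tested with the functionals `w ↦ w ζ` for `ζ ∈ V`. -/
theorem hasWeakDeriv_iff [CompleteSpace V] {u : L2I T V} {w : L2I T (StrongDual ℝ V)} :
    HasWeakDeriv T j u w ↔ ∀ φ : ℝ → ℝ, ContDiff ℝ (⊤ : ℕ∞) φ → HasCompactSupport φ →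
      tsupport φ ⊆ Ioo 0 T → ∀ ζ : V,
        ∫ t in Ioo 0 T, deriv φ t * inner ℝ (j (u t)) (j ζ) = -∫ t in Ioo 0 T, φ t * w t ζ := by
  have key : ∀ φ : ℝ → ℝ, ContDiff ℝ (⊤ : ℕ∞) φ → HasCompactSupport φ → ∀ ζ : V,
      (∫ t in Ioo 0 T, deriv φ t • gelfand j (u t)) ζ =
        ∫ t in Ioo 0 T, deriv φ t * inner ℝ (j (u t)) (j ζ) ∧
      (-∫ t in Ioo 0 T, φ t • w t) ζ = -∫ t in Ioo 0 T, φ t * w t ζ := by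
    intro φ h1 h2 ζ
    have i1 := integrable_smul_L2I ((gelfand j).integrable_comp (integrable_L2I u))
      (h1.continuous_deriv (by simp)) h2.deriv
    have i2 := integrable_smul_L2I (integrable_L2I w) h1.continuous h2
    rw [neg_apply, ContinuousLinearMap.integral_apply i1, ContinuousLinearMap.integral_apply i2]
    exact ⟨rfl, rfl⟩
  refine forall_congr' fun φ => forall_congr' fun h1 => forall_congr' fun h2 => forall_congr'
    fun _ => ?_
  rw [ContinuousLinearMap.ext_iff]
  exact forall_congr' fun ζ => by rw [(key φ h1 h2 ζ).1, (key φ h1 h2 ζ).2]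

theorem memLp_smul_const {E : Type*} [NormedAddCommGroup E] [NormedSpace ℝ E] {φ : ℝ → ℝ}
    (hφ : Continuous φ) (hc : HasCompactSupport φ) (e : E) :
    MemLp (fun t => φ t • e) 2 (timeMeasure T) := by
  have : IsFiniteMeasure (timeMeasure T) := ⟨by simp [timeMeasure]⟩
  obtain ⟨C, hC⟩ := hφ.bounded_above_of_compact_support hc
  refine MemLp.of_bound (hφ.smul continuous_const).aestronglyMeasurable (C * ‖e‖)
    (Filter.Eventually.of_forall fun t => ?_)
  rw [norm_smul]
  exact mul_le_mul_of_nonneg_right (hC t) (norm_nonneg _)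

/-- `X` is complete, since the weak derivative is a closed operator. -/
theorem isClosed_spaceX [CompleteSpace V] :
    IsClosed (spaceX T j : Set (L2I T V × L2I T (StrongDual ℝ V))) := by
  have hset : (spaceX T j : Set (L2I T V × L2I T (StrongDual ℝ V))) =
      {p | ∀ φ : ℝ → ℝ, ContDiff ℝ (⊤ : ℕ∞) φ → HasCompactSupport φ →
        tsupport φ ⊆ Ioo 0 T → ∀ ζ : V, ∫ t in Ioo 0 T, deriv φ t * inner ℝ (j (p.1 t)) (j ζ) =
          -∫ t in Ioo 0 T, φ t * p.2 t ζ} := by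
    ext p
    exact hasWeakDeriv_iff
  rw [hset]
  simp only [ofPred_forall]
  refine isClosed_iInter fun φ => isClosed_iInter fun h1 => isClosed_iInter fun h2 =>
    isClosed_iInter fun _ => isClosed_iInter fun ζ => ?_
  have m1 := memLp_smul_const (T := T) (h1.continuous_deriv (by simp)) h2.deriv (gelfand j ζ)
  have m2 := memLp_smul_const (T := T) h1.continuous h2 ζ
  -- Both sides are pairings with a fixed element of `L₂(I; V')` or `L₂(I; V)`.
  have e1 : ∀ p : L2I T V × L2I T (StrongDual ℝ V),
      ∫ t in Ioo 0 T, deriv φ t * inner ℝ (j (p.1 t)) (j ζ) = dualPairing T V m1.toLp p.1 := by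
    intro p
    rw [dualPairing_apply]
    refine integral_congr_ae ?_
    filter_upwards [m1.coeFn_toLp] with t ht
    rw [ht, real_inner_comm]
    rfl
  have e2 : ∀ p : L2I T V × L2I T (StrongDual ℝ V),
      ∫ t in Ioo 0 T, φ t * p.2 t ζ = dualPairing T V p.2 m2.toLp := by
    intro p
    rw [dualPairing_apply]
    refine integral_congr_ae ?_
    filter_upwards [m2.coeFn_toLp] with t ht
    rw [ht, map_smul, smul_eq_mul]
  simp only [e1, e2]
  exact isClosed_eq (by fun_prop) (by fun_prop)

instance [CompleteSpace V] : CompleteSpace (spaceX T j) := isClosed_spaceX.completeSpace_coe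

end Bochner

/-! ### Weakly differentiable scalar functions -/

section Scalar

open Filter Topology

variable {T : ℝ}

theorem integral_deriv_mul_primitive {q φ : ℝ → ℝ}
    (hq : IntervalIntegrable q volume 0 T) (hφ : ContDiff ℝ (⊤ : ℕ∞) φ)
    (hsupp : tsupport φ ⊆ Ioo 0 T) :
    ∫ t in (0)..T, deriv φ t * ∫ r in (0)..t, q r = -∫ t in (0)..T, φ t * q t := by
  have hφac : AbsolutelyContinuousOnInterval φ 0 T :=
    (hφ.of_le (by simp)).contDiffOn.absolutelyContinuousOnInterval
  have hqac := hq.absolutelyContinuousOnInterval_intervalIntegral (c := 0) (by simp)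
  have h := hφac.integral_mul_deriv_eq_deriv_mul hqac
  have h0 : φ 0 = 0 := image_eq_zero_of_notMem_tsupport fun h => by simpa using hsupp h
  have hT0 : φ T = 0 := image_eq_zero_of_notMem_tsupport fun h => by simpa using hsupp h
  have h1 : ∫ t in (0)..T, φ t * deriv (fun x => ∫ r in (0)..x, q r) t =
      ∫ t in (0)..T, φ t * q t := by
    refine intervalIntegral.integral_congr_ae ?_
    filter_upwards [hq.ae_hasDerivAt_integral] with t ht htmem
    rw [(ht (uIoc_subset_uIcc htmem) 0 (by simp)).deriv]
  rw [h0, hT0, h1] at h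
  linarith

/-- A test function with vanishing mean is the derivative of a test function. -/
theorem exists_deriv_eq_of_integral_eq_zero {ψ : ℝ → ℝ}
    (hψ : ContDiff ℝ (⊤ : ℕ∞) ψ) (hc : HasCompactSupport ψ) (hsupp : tsupport ψ ⊆ Ioo 0 T)
    (h0 : ∫ t in Ioo 0 T, ψ t = 0) :
    ∃ φ : ℝ → ℝ, ContDiff ℝ (⊤ : ℕ∞) φ ∧ HasCompactSupport φ ∧ tsupport φ ⊆ Ioo 0 T ∧
      deriv φ = ψ := by
  obtain hne | hne := (tsupport ψ).eq_empty_or_nonempty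
  · refine ⟨0, contDiff_const, HasCompactSupport.zero, by simp [tsupport], ?_⟩
    rw [tsupport_eq_empty_iff] at hne
    ext t
    simp [hne]
  have hα := hc.isCompact.sInf_mem hne
  have hβ := hc.isCompact.sSup_mem hne
  set α := sInf (tsupport ψ)
  set β := sSup (tsupport ψ)
  have hsub : tsupport ψ ⊆ Icc α β := fun t ht =>
    ⟨csInf_le hc.isCompact.bddBelow ht, le_csSup hc.isCompact.bddAbove ht⟩
  have hz : ∀ t, t ∉ Icc α β → ψ t = 0 := fun t ht =>
    image_eq_zero_of_notMem_tsupport fun h => ht (hsub h)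
  have hint : ∀ x y, IntervalIntegrable ψ volume x y := fun x y =>
    hψ.continuous.intervalIntegrable x y
  have hderiv : ∀ t, HasDerivAt (fun x => ∫ r in (0)..x, ψ r) (ψ t) t := fun t =>
    (hψ.continuous.integral_hasStrictDerivAt 0 t).hasDerivAt
  have hd : deriv (fun x => ∫ r in (0)..x, ψ r) = ψ := funext fun t => (hderiv t).deriv
  have hT : 0 < T := (hsupp hα).1.trans (hsupp hα).2
  have hts : tsupport (fun x => ∫ r in (0)..x, ψ r) ⊆ Icc α β := by
    refine closure_minimal (fun t ht => ?_) isClosed_Icc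
    by_contra hcon
    refine ht ?_
    rw [mem_Icc, not_and_or, not_le, not_le] at hcon
    rcases hcon with hcon | hcon
    · refine intervalIntegral.integral_zero_ae (Eventually.of_forall fun r hr => hz r fun h => ?_)
      have h1 := (hsupp hα).1
      have h2 := h.1
      rcases mem_uIoc.1 hr with hr | hr <;> linarith [hr.2]
    · have h1 : ∫ r in (0)..T, ψ r = 0 := by
        rw [intervalIntegral.integral_of_le hT.le, integral_Ioc_eq_integral_Ioo, h0]
      have h2 : ∫ r in t..T, ψ r = 0 := by
        refine intervalIntegral.integral_zero_ae (Eventually.of_forall fun r hr => hz r fun h => ?_)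
        have h1 := (hsupp hβ).2
        have h2 := h.2
        rcases mem_uIoc.1 hr with hr | hr <;> linarith [hr.1]
      have h3 := intervalIntegral.integral_add_adjacent_intervals (hint 0 t) (hint t T)
      simp only
      linarith
  refine ⟨fun x => ∫ r in (0)..x, ψ r, ?_, ?_, ?_, hd⟩
  · rw [contDiff_infty_iff_deriv, hd]
    exact ⟨fun t => (hderiv t).differentiableAt, hψ⟩
  · exact HasCompactSupport.of_support_subset_isCompact isCompact_Icc
      ((subset_tsupport _).trans hts)
  · exact hts.trans (Icc_subset_Ioo (hsupp hα).1 (hsupp hβ).2)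

/-- An integrable function with integrable weak derivative is, up to a constant, the primitive of
that derivative. -/
theorem exists_ae_eq_const_add_integral (hT : 0 < T) {p q : ℝ → ℝ}
    (hp : IntegrableOn p (Ioo 0 T)) (hq : IntegrableOn q (Ioo 0 T))
    (h : ∀ φ : ℝ → ℝ, ContDiff ℝ (⊤ : ℕ∞) φ → HasCompactSupport φ → tsupport φ ⊆ Ioo 0 T →
      ∫ t in Ioo 0 T, deriv φ t * p t = -∫ t in Ioo 0 T, φ t * q t) :
    ∃ c : ℝ, ∀ᵐ t ∂(timeMeasure T), p t = c + ∫ r in (0)..t, q r := by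
  have hq' : IntervalIntegrable q volume 0 T := by
    rwa [intervalIntegrable_iff_integrableOn_Ioo_of_le hT.le]
  set Q : ℝ → ℝ := fun t => ∫ r in (0)..t, q r
  have hQc : ContinuousOn Q (Icc 0 T) := by
    have := (hq'.absolutelyContinuousOnInterval_intervalIntegral (c := 0) (by simp)).continuousOn
    rwa [uIcc_of_le hT.le] at this
  have hQ : IntegrableOn Q (Ioo 0 T) := hQc.integrableOn_Icc.mono_set Ioo_subset_Icc_self
  have hII : ∀ f : ℝ → ℝ, ∫ t in (0)..T, f t = ∫ t in Ioo 0 T, f t := fun f => by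
    rw [intervalIntegral.integral_of_le hT.le, integral_Ioc_eq_integral_Ioo]
  have hf : Integrable (fun t => p t - Q t) (timeMeasure T) := hp.sub hQ
  have hz : ∀ φ : ℝ → ℝ, ContDiff ℝ (⊤ : ℕ∞) φ → HasCompactSupport φ → tsupport φ ⊆ Ioo 0 T →
      ∫ t in Ioo 0 T, deriv φ t * (p t - Q t) = 0 := by
    intro φ h1 h2 h3
    have hd := h1.continuous_deriv (by simp)
    have e1 := integral_deriv_mul_primitive hq' h1 h3
    rw [hII, hII] at e1
    have i1 : Integrable (fun t => deriv φ t * p t) (timeMeasure T) :=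
      integrable_smul_L2I hp hd h2.deriv
    have i2 : Integrable (fun t => deriv φ t * Q t) (timeMeasure T) :=
      integrable_smul_L2I hQ hd h2.deriv
    simp only [mul_sub]
    rw [integral_sub i1 i2, h φ h1 h2 h3, e1, sub_self]
  -- A test function with mean one, to correct the mean of the others.
  let B : ContDiffBump (T / 2) := ⟨T / 8, T / 4, by positivity, by linarith⟩
  set θ : ℝ → ℝ := B.normed volume
  have hθs : tsupport θ ⊆ Ioo 0 T := by
    rw [B.tsupport_normed_eq, Real.closedBall_eq_Icc]
    exact Icc_subset_Ioo (by simp only [B]; linarith) (by simp only [B]; linarith)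
  have hθ1 : ∫ t in Ioo 0 T, θ t = 1 := by
    rw [setIntegral_eq_integral_of_forall_compl_eq_zero fun t ht =>
      image_eq_zero_of_notMem_tsupport fun h => ht (hθs h)]
    exact B.integral_normed
  have hθc : ContDiff ℝ (⊤ : ℕ∞) θ := B.contDiff_normed
  have hθk : HasCompactSupport θ := B.hasCompactSupport_normed
  set c := ∫ t in Ioo 0 T, θ t * (p t - Q t)
  have hfin : IsFiniteMeasure (timeMeasure T) := ⟨by simp [timeMeasure]⟩
  have hcont : ∀ ψ : ℝ → ℝ, Continuous ψ → IntegrableOn ψ (Ioo 0 T) := fun ψ hψ =>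
    (hψ.continuousOn.integrableOn_Icc (a := 0) (b := T)).mono_set Ioo_subset_Icc_self
  have hfc : IntegrableOn (fun t => p t - Q t - c) (Ioo 0 T) := hf.sub (integrable_const c)
  have := isOpen_Ioo.ae_eq_zero_of_integral_contDiff_smul_eq_zero (μ := volume)
    hfc.locallyIntegrableOn (fun ψ h1 h2 h3 => by
      set m := ∫ t in Ioo 0 T, ψ t
      have k1 : ContDiff ℝ (⊤ : ℕ∞) (fun t => ψ t - m * θ t) := h1.sub (contDiff_const.mul hθc)
      have ks : tsupport (fun t => ψ t - m * θ t) ⊆ tsupport ψ ∪ tsupport θ := by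
        refine closure_minimal (fun t ht => ?_) ((isClosed_tsupport _).union (isClosed_tsupport _))
        by_contra hcon
        rw [mem_union, not_or] at hcon
        refine ht ?_
        simp [image_eq_zero_of_notMem_tsupport hcon.1, image_eq_zero_of_notMem_tsupport hcon.2]
      obtain ⟨φ, f1, f2, f3, f4⟩ := exists_deriv_eq_of_integral_eq_zero k1
        (HasCompactSupport.of_support_subset_isCompact (h2.isCompact.union hθk.isCompact)
          ((subset_tsupport _).trans ks)) (ks.trans (union_subset h3 hθs)) (by
          rw [integral_sub (hcont _ h1.continuous) ((hcont _ hθc.continuous).const_mul m),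
            integral_const_mul, hθ1, mul_one, sub_self])
      have e := hz φ f1 f2 f3
      rw [f4] at e
      have i1 : Integrable (fun t => ψ t * (p t - Q t)) (timeMeasure T) :=
        integrable_smul_L2I hf h1.continuous h2
      have i2 : Integrable (fun t => θ t * (p t - Q t)) (timeMeasure T) :=
        integrable_smul_L2I hf hθc.continuous hθk
      have e1 : ∫ t in Ioo 0 T, (ψ t - m * θ t) * (p t - Q t) =
          (∫ t in Ioo 0 T, ψ t * (p t - Q t)) - m * c := by
        rw [← integral_const_mul, ← integral_sub i1 (i2.const_mul m)]
        exact integral_congr_ae (Eventually.of_forall fun t => by ring)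
      have hzero : ∀ t, t ∉ Ioo 0 T → ψ t • (p t - Q t - c) = 0 := fun t ht => by
        rw [image_eq_zero_of_notMem_tsupport fun h => ht (h3 h), zero_smul]
      rw [← setIntegral_eq_integral_of_forall_compl_eq_zero hzero]
      calc ∫ t in Ioo 0 T, ψ t • (p t - Q t - c)
          = ∫ t in Ioo 0 T, (ψ t * (p t - Q t) - ψ t * c) :=
            integral_congr_ae (Eventually.of_forall fun t => by simp only [smul_eq_mul]; ring)
        _ = (∫ t in Ioo 0 T, ψ t * (p t - Q t)) - m * c := by
            rw [integral_sub i1 ((hcont _ h1.continuous).mul_const c), integral_mul_const]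
        _ = 0 := by rw [← e1, e])
  refine ⟨c, ?_⟩
  rw [timeMeasure, ae_restrict_iff' measurableSet_Ioo]
  filter_upwards [this] with t ht htI
  linarith [ht htI]

end Scalar

/-! ### A basis that is orthogonal in `V` and in `H` -/

section Eigenbasis

universe u

variable {V : Type u} {H : Type*} [NormedAddCommGroup V] [InnerProductSpace ℝ V] [CompleteSpace V]
  [NormedAddCommGroup H] [InnerProductSpace ℝ H]

theorem _root_.Orthonormal.countable {E ι : Type*} [NormedAddCommGroup E]
    [InnerProductSpace ℝ E] [TopologicalSpace.SeparableSpace E] {v : ι → E}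
    (hv : Orthonormal ℝ v) : Countable ι := by
  refine Pairwise.countable_of_isOpen_disjoint (s := fun i => Metric.ball (v i) (1 / 2)) ?_
    (fun i => Metric.isOpen_ball) (fun i => ⟨v i, by simp⟩)
  intro i k hik
  refine Metric.ball_disjoint_ball ?_
  have h : ‖v i - v k‖ ^ 2 = 2 := by
    rw [norm_sub_sq_real, hv.1, hv.1, hv.2 hik]
    norm_num
  rw [dist_eq_norm]
  nlinarith [norm_nonneg (v i - v k)]

/-- The eigenvectors of the compact operator `j* j` form a Hilbert basis of `V` that is also
orthogonal in `H`. -/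
theorem exists_hilbertBasis_eigenvectors [CompleteSpace H] [TopologicalSpace.SeparableSpace V]
    {j : V →L[ℝ] H} (hj : Function.Injective j) (hc : IsCompactOperator j) :
    ∃ (κ : Type u) (b : HilbertBasis κ ℝ V) (lam : κ → ℝ), Countable κ ∧ (∀ i, 0 < lam i) ∧
      ∀ i v, inner ℝ (j v) (j (b i)) = lam i * inner ℝ v (b i) := by
  let A : V →L[ℝ] V := ContinuousLinearMap.adjoint j ∘L j
  have hAin : ∀ x y, inner ℝ (A x) y = inner ℝ (j x) (j y) := fun x y =>
    ContinuousLinearMap.adjoint_inner_left j y (j x)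
  have hA : IsCompactOperator A := hc.clm_comp (ContinuousLinearMap.adjoint j)
  have hAs : A.IsSymmetric := fun x y => by
    change inner ℝ (A x) y = inner ℝ x (A y)
    rw [hAin, real_inner_comm (A y), hAin, real_inner_comm]
  have hbot := ContinuousLinearMap.orthogonalComplement_iSup_eigenspaces_eq_bot hA hAs
  have hcomp : ∀ μ : ℝ, CompleteSpace (Module.End.eigenspace (A : Module.End ℝ V) μ) := by
    intro μ
    have : IsClosed (Module.End.eigenspace (A : Module.End ℝ V) μ : Set V) := by
      have h : (Module.End.eigenspace (A : Module.End ℝ V) μ : Set V) = {x | A x = μ • x} := by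
        ext x
        exact Module.End.mem_eigenspace_iff
      rw [h]
      exact isClosed_eq A.continuous (continuous_const_smul μ)
    exact this.completeSpace_coe
  choose w e he using fun μ : ℝ =>
    exists_hilbertBasis ℝ (Module.End.eigenspace (A : Module.End ℝ V) μ)
  have hortho := hAs.orthogonalFamily_eigenspaces.orthonormal_sigma_orthonormal
    fun μ => (e μ).orthonormal
  let v : (Σ μ : ℝ, w μ) → V := fun i => (e i.1 i.2 : V)
  have hv : Orthonormal ℝ v := hortho
  have hspan : (Submodule.span ℝ (range v))ᗮ = ⊥ := by
    rw [eq_bot_iff, ← hbot]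
    intro x hx
    rw [Submodule.mem_orthogonal'] at hx ⊢
    intro y hy
    have hle : ∀ μ, ∀ z ∈ Module.End.eigenspace (A : Module.End ℝ V) μ, inner ℝ x z = 0 := by
      intro μ z hz
      have h1 := (e μ).hasSum_repr ⟨z, hz⟩
      have h2 := (h1.mapL (Submodule.subtypeL _)).mapL (innerSL ℝ x)
      refine h2.unique (hasSum_zero.congr_fun fun i => ?_)
      have h3 : inner ℝ x (e μ i : V) = 0 := hx _ (Submodule.subset_span ⟨⟨μ, i⟩, rfl⟩)
      simp [h3]
    induction hy using Submodule.iSup_induction' with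
    | mem μ z hz => exact hle μ z hz
    | zero => exact inner_zero_right _
    | add y z _ _ hy hz => rw [inner_add_right, hy, hz, add_zero]
  have hin : ∀ i x, inner ℝ (j x) (j (v i)) = i.1 * inner ℝ x (v i) := by
    intro i x
    have h1 : A (v i) = i.1 • v i := Module.End.mem_eigenspace_iff.1 (e i.1 i.2).2
    rw [real_inner_comm, ← hAin, h1, real_inner_smul_left, real_inner_comm]
  refine ⟨_, HilbertBasis.mkOfOrthogonalEqBot hv hspan, fun i => i.1, hv.countable, fun i => ?_, ?_⟩
  · have h1 := hin i (v i)
    have h2 : v i ≠ 0 := hv.ne_zero i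
    rw [real_inner_self_eq_norm_sq, real_inner_self_eq_norm_sq, hv.1 i, one_pow, mul_one] at h1
    change 0 < i.1
    rw [← h1]
    exact pow_pos (norm_pos_iff.2 fun h => h2 (hj (h.trans (map_zero j).symm))) 2
  · intro i x
    rw [HilbertBasis.coe_mkOfOrthogonalEqBot]
    exact hin i x

end Eigenbasis

/-! ### The energy identity almost everywhere -/

section Energy

open Filter Topology

variable {V H : Type*} [NormedAddCommGroup V] [InnerProductSpace ℝ V]
  [NormedAddCommGroup H] [InnerProductSpace ℝ H]
  {T : ℝ} {j : V →L[ℝ] H} {u : L2I T V} {w : L2I T (StrongDual ℝ V)}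

/-- The energy identity for one coordinate: if `p = c + ∫ q` at `a`, at `b`, and almost everywhere,
then the chain rule `(p²)' = 2 q p` may be integrated from `a` to `b`. -/
theorem sq_sub_sq_eq_of_ae_eq_primitive {p q : ℝ → ℝ} {c k a b : ℝ}
    (ha : a ∈ Ioo 0 T) (hb : b ∈ Ioo 0 T) (hq : IntegrableOn q (Ioo 0 T))
    (hp : ∀ᵐ t ∂(timeMeasure T), p t = c + ∫ r in (0)..t, q r)
    (hpa : p a = c + ∫ r in (0)..a, q r) (hpb : p b = c + ∫ r in (0)..b, q r) :
    (p b - k) ^ 2 - (p a - k) ^ 2 = 2 * ∫ t in a..b, q t * (p t - k) := by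
  have hT : 0 < T := ha.1.trans ha.2
  have hq' : IntervalIntegrable q volume 0 T := by
    rwa [intervalIntegrable_iff_integrableOn_Ioo_of_le hT.le]
  have hsub : uIcc a b ⊆ Ioo 0 T := by
    rcases le_total a b with h | h
    · rw [uIcc_of_le h]; exact Icc_subset_Ioo ha.1 hb.2
    · rw [uIcc_of_ge h]; exact Icc_subset_Ioo hb.1 ha.2
  have hsub' : uIcc a b ⊆ uIcc 0 T := hsub.trans (Ioo_subset_Icc_self.trans Icc_subset_uIcc)
  set G : ℝ → ℝ := fun t => (c - k) + ∫ r in (0)..t, q r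
  have hG : AbsolutelyContinuousOnInterval G a b := by
    have h1 : AbsolutelyContinuousOnInterval (fun _ : ℝ => c - k) a b :=
      (contDiff_const (n := 1)).contDiffOn.absolutelyContinuousOnInterval
    exact h1.add ((hq'.absolutelyContinuousOnInterval_intervalIntegral (c := 0) (by simp)).mono
      hsub')
  have h := hG.integral_deriv_mul_eq_sub hG
  have hcongr : ∫ x in a..b, deriv G x * G x + G x * deriv G x =
      ∫ t in a..b, 2 * (q t * (p t - k)) := by
    refine intervalIntegral.integral_congr_ae ?_
    rw [timeMeasure, ae_restrict_iff' measurableSet_Ioo] at hp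
    filter_upwards [hq'.ae_hasDerivAt_integral, hp] with t ht hpt htmem
    have hmem := uIoc_subset_uIcc htmem
    have hd : deriv G t = q t := ((ht (hsub' hmem) 0 (by simp)).const_add (c - k)).deriv
    have hGt : G t = p t - k := by
      rw [hpt (hsub hmem)]
      simp only [G]
      ring
    rw [hd, hGt]
    ring
  rw [hcongr, intervalIntegral.integral_const_mul] at h
  have hGa : G a = p a - k := by rw [hpa]; simp only [G]; ring
  have hGb : G b = p b - k := by rw [hpb]; simp only [G]; ring
  rw [h, hGa, hGb]
  ring

theorem integrable_norm_mul_norm_sub (e : V) :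
    Integrable (fun t => ‖w t‖ * ‖u t - e‖) (timeMeasure T) := by
  have : IsFiniteMeasure (timeMeasure T) := ⟨by simp [timeMeasure]⟩
  exact (Lp.memLp w).norm.integrable_mul ((Lp.memLp u).sub (memLp_const e)).norm

/-- The energy identity, including its variants for the functions `u - e` with `e ∈ V` constant,
holds between almost all times. It is the sum over the coordinates in a basis that is orthogonal
both in `V` and in `H`: the sum converges because the expansion of `u(t)` converges in `V`. -/
theorem exists_energy_identity [CompleteSpace V] [CompleteSpace H] [TopologicalSpace.SeparableSpace V]
    (hj : Function.Injective j) (hc : IsCompactOperator j) (hT : 0 < T)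
    (h : HasWeakDeriv T j u w) :
    ∃ D ⊆ Ioo 0 T, (∀ᵐ t ∂(timeMeasure T), t ∈ D) ∧ ∀ a ∈ D, ∀ b ∈ D, ∀ e : V,
      ‖j (u b - e)‖ ^ 2 - ‖j (u a - e)‖ ^ 2 = 2 * ∫ t in a..b, w t (u t - e) := by
  obtain ⟨κ, v, lam, hκ, hlam, hv⟩ := exists_hilbertBasis_eigenvectors hj hc
  have hwint : ∀ ζ : V, IntegrableOn (fun t => w t ζ) (Ioo 0 T) := fun ζ =>
    (integrable_L2I w).apply_continuousLinearMap ζ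
  have huint : ∀ ζ : V, IntegrableOn (fun t => inner ℝ (j (u t)) (j ζ)) (Ioo 0 T) := fun ζ =>
    ((gelfand j).integrable_comp (integrable_L2I u)).apply_continuousLinearMap ζ
  rw [hasWeakDeriv_iff] at h
  choose c hcoord using fun i => exists_ae_eq_const_add_integral hT (huint (v i)) (hwint (v i))
    fun φ h1 h2 h3 => h φ h1 h2 h3 (v i)
  refine ⟨{t | t ∈ Ioo 0 T ∧ ∀ i, inner ℝ (j (u t)) (j (v i)) = c i + ∫ r in (0)..t, w r (v i)},
    fun t ht => ht.1, ?_, ?_⟩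
  · filter_upwards [ae_all_iff.2 hcoord, ae_restrict_mem measurableSet_Ioo] with t h1 h2
    exact ⟨h2, h1⟩
  rintro a ⟨ha, hca⟩ b ⟨hb, hcb⟩ e
  have hone : ∀ i, lam i * inner ℝ (u b - e) (v i) ^ 2 - lam i * inner ℝ (u a - e) (v i) ^ 2 =
      2 * ∫ t in a..b, w t (v i) * inner ℝ (u t - e) (v i) := by
    intro i
    have h1 := sq_sub_sq_eq_of_ae_eq_primitive (k := inner ℝ (j e) (j (v i))) ha hb (hwint (v i))
      (hcoord i) (hca i) (hcb i)
    have hk : ∀ x, inner ℝ (j x) (j (v i)) - inner ℝ (j e) (j (v i)) =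
        lam i * inner ℝ (x - e) (v i) := fun x => by
      rw [hv, hv, inner_sub_left]
      ring
    have hr : ∀ t, w t (v i) * (lam i * inner ℝ (u t - e) (v i)) =
        lam i * (w t (v i) * inner ℝ (u t - e) (v i)) := fun t => by ring
    simp only [hk, hr, intervalIntegral.integral_const_mul] at h1
    refine mul_left_cancel₀ (hlam i).ne' ?_
    linarith
  have hnorm : ∀ x, HasSum (fun i => lam i * inner ℝ x (v i) ^ 2) (‖j x‖ ^ 2) := by
    intro x
    have h1 := (v.hasSum_repr x).mapL ((gelfand j) x)
    have h2 : gelfand j x x = ‖j x‖ ^ 2 := real_inner_self_eq_norm_sq _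
    rw [h2] at h1
    refine h1.congr_fun fun i => ?_
    have h3 : gelfand j x (v i) = lam i * inner ℝ x (v i) := hv i x
    rw [map_smul, h3, v.repr_apply_apply, real_inner_comm, smul_eq_mul]
    ring
  have hsum : ∀ (f : StrongDual ℝ V) (x : V),
      HasSum (fun i => f (v i) * inner ℝ x (v i)) (f x) := by
    intro f x
    refine ((v.hasSum_repr x).mapL f).congr_fun fun i => ?_
    rw [map_smul, v.repr_apply_apply, real_inner_comm, smul_eq_mul, mul_comm]
  have hbound : ∀ (f : StrongDual ℝ V) (x : V) (s : Finset κ),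
      ‖∑ i ∈ s, f (v i) * inner ℝ x (v i)‖ ≤ ‖f‖ * ‖x‖ := by
    intro f x s
    have h1 : ∑ i ∈ s, f (v i) * inner ℝ x (v i) = f (∑ i ∈ s, inner ℝ x (v i) • v i) := by
      simp [mul_comm]
    have h2 : ‖∑ i ∈ s, (inner ℝ x (v i) : ℝ) • v i‖ ≤ ‖x‖ := by
      refine (pow_le_pow_iff_left₀ (norm_nonneg _) (norm_nonneg _) two_ne_zero).1 ?_
      rw [← real_inner_self_eq_norm_sq, v.orthonormal.inner_sum]
      refine le_trans (le_of_eq (Finset.sum_congr rfl fun i _ => ?_))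
        (v.orthonormal.sum_inner_products_le (x := x) (s := s))
      rw [real_inner_comm, Real.norm_eq_abs, sq_abs, sq]
      simp
    rw [h1]
    exact (f.le_opNorm _).trans (by gcongr)
  have hsub : uIoc a b ⊆ Ioo 0 T := by
    refine uIoc_subset_uIcc.trans ?_
    rcases le_total a b with h | h
    · rw [uIcc_of_le h]; exact Icc_subset_Ioo ha.1 hb.2
    · rw [uIcc_of_ge h]; exact Icc_subset_Ioo hb.1 ha.2
  have hmeas : ∀ i, AEStronglyMeasurable (fun t => w t (v i) * inner ℝ (u t - e) (v i))
      (timeMeasure T) := fun i =>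
    (hwint (v i)).aestronglyMeasurable.mul
      (((Lp.aestronglyMeasurable u).sub aestronglyMeasurable_const).inner
        aestronglyMeasurable_const)
  have hII : ∀ i, IntervalIntegrable (fun t => w t (v i) * inner ℝ (u t - e) (v i)) volume a b := by
    intro i
    rw [intervalIntegrable_iff]
    refine IntegrableOn.mono_set ?_ hsub
    refine (integrable_norm_mul_norm_sub (w := w) (u := u) e).mono' (hmeas i)
      (Eventually.of_forall fun t => ?_)
    simpa using hbound (w t) (u t - e) {i}
  have hlim : Tendsto (fun s : Finset κ => ∫ t in a..b, ∑ i ∈ s,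
      w t (v i) * inner ℝ (u t - e) (v i)) atTop (𝓝 (∫ t in a..b, w t (u t - e))) := by
    refine intervalIntegral.tendsto_integral_filter_of_dominated_convergence
      (fun t => ‖w t‖ * ‖u t - e‖) (Eventually.of_forall fun s => ?_)
      (Eventually.of_forall fun s => Eventually.of_forall fun t _ => hbound _ _ s) ?_
      (Eventually.of_forall fun t _ => hsum _ _)
    · exact (Finset.aestronglyMeasurable_fun_sum s fun i _ => hmeas i).mono_measure
        (Measure.restrict_mono hsub le_rfl)
    · rw [intervalIntegrable_iff]
      exact (integrable_norm_mul_norm_sub (w := w) (u := u) e).mono_measure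
        (Measure.restrict_mono hsub le_rfl)
  refine tendsto_nhds_unique ((hnorm (u b - e)).sub (hnorm (u a - e))) ?_
  refine (hlim.const_mul 2).congr fun s => ?_
  rw [intervalIntegral.integral_finsetSum fun i _ => hII i, Finset.mul_sum]
  exact Finset.sum_congr rfl fun i _ => (hone i).symm

end Energy

/-! ### The continuous representative -/

section Representative

open Filter Topology

variable {V H : Type*} [NormedAddCommGroup V] [InnerProductSpace ℝ V]
  [NormedAddCommGroup H] [InnerProductSpace ℝ H]
  {T : ℝ} {j : V →L[ℝ] H} {u : L2I T V} {w : L2I T (StrongDual ℝ V)} {D : Set ℝ}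

/-- The oscillation of `u` over an interval `J` is controlled by its norms in `L₂(J; V)` and
`H¹(J; V')`. The energy identity is applied to `u - u(a)`, where the time `a` is chosen such that
`‖u(a)‖_V²` is at most the mean of `‖u‖_V²` over `J`; the factors `|J|` then cancel. -/
theorem exists_norm_sub_sq_le (hDae : ∀ᵐ t ∂(timeMeasure T), t ∈ D)
    (hD : ∀ a ∈ D, ∀ b ∈ D, ∀ e : V,
      ‖j (u b - e)‖ ^ 2 - ‖j (u a - e)‖ ^ 2 = 2 * ∫ t in a..b, w t (u t - e))
    {α β : ℝ} (hαβ : α < β) (hJ : Ioo α β ⊆ Ioo 0 T) :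
    ∃ a ∈ D, (β - α) * ‖u a‖ ^ 2 ≤ ∫ t in Ioo α β, ‖u t‖ ^ 2 ∧
      ∀ b ∈ D, b ∈ Ioo α β → ‖j (u b) - j (u a)‖ ^ 2 ≤
        4 * (√(∫ t in Ioo α β, ‖w t‖ ^ 2) * √(∫ t in Ioo α β, ‖u t‖ ^ 2)) := by
  have hrestr : volume.restrict (Ioo α β) ≤ timeMeasure T := Measure.restrict_mono hJ le_rfl
  have hu : MemLp u 2 (volume.restrict (Ioo α β)) := (Lp.memLp u).mono_measure hrestr
  have hw : MemLp w 2 (volume.restrict (Ioo α β)) := (Lp.memLp w).mono_measure hrestr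
  have hne : volume.restrict (Ioo α β) ≠ 0 := by
    rw [Ne, Measure.restrict_eq_zero, Real.volume_Ioo, ENNReal.ofReal_eq_zero]
    linarith
  have hnull : volume.restrict (Ioo α β) {t | ¬ (t ∈ D ∧ t ∈ Ioo α β)} = 0 := by
    have h1 : ∀ᵐ t ∂(volume.restrict (Ioo α β)), t ∈ D := hDae.filter_mono (ae_mono hrestr)
    exact ae_iff.1 (h1.and (ae_restrict_mem measurableSet_Ioo))
  obtain ⟨a, haN, ha⟩ := exists_notMem_null_le_average hne (hu.integrable_norm_pow two_ne_zero)
    hnull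
  obtain ⟨haD, haJ⟩ : a ∈ D ∧ a ∈ Ioo α β := by
    by_contra hcon
    exact haN hcon
  have hmean : (β - α) * ‖u a‖ ^ 2 ≤ ∫ t in Ioo α β, ‖u t‖ ^ 2 := by
    rw [average_eq, measureReal_restrict_apply_univ, Real.volume_real_Ioo_of_le hαβ.le,
      smul_eq_mul, inv_mul_eq_div, le_div_iff₀ (by linarith)] at ha
    linarith
  refine ⟨a, haD, hmean, fun b hbD hbJ => ?_⟩
  have hE := hD a haD b hbD (u a)
  rw [sub_self, map_zero, norm_zero, map_sub] at hE
  have hsub : uIoc a b ⊆ Ioo α β := by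
    refine uIoc_subset_uIcc.trans ?_
    rcases le_total a b with h | h
    · rw [uIcc_of_le h]; exact Icc_subset_Ioo haJ.1 hbJ.2
    · rw [uIcc_of_ge h]; exact Icc_subset_Ioo hbJ.1 haJ.2
  set W := √(∫ t in Ioo α β, ‖w t‖ ^ 2)
  set U := √(∫ t in Ioo α β, ‖u t‖ ^ 2)
  have hU : √(β - α) * ‖u a‖ ≤ U := by
    refine Real.le_sqrt_of_sq_le ?_
    rwa [mul_pow, Real.sq_sqrt (by linarith)]
  have i1 : Integrable (fun t => ‖w t‖ * ‖u t‖) (volume.restrict (Ioo α β)) :=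
    hw.norm.integrable_mul hu.norm
  have i2 : Integrable (fun t => ‖w t‖) (volume.restrict (Ioo α β)) :=
    (hw.integrable (by norm_num)).norm
  have h1 : ∫ t in Ioo α β, ‖w t‖ * ‖u t‖ ≤ W * U := integral_norm_mul_norm_le hw hu
  have h2 : ∫ t in Ioo α β, ‖w t‖ ≤ W * √(β - α) := by
    have := integral_norm_mul_norm_le hw (memLp_const (μ := volume.restrict (Ioo α β)) (1 : ℝ))
    simpa [Real.volume_real_Ioo_of_le hαβ.le] using this
  have h3 : |∫ t in a..b, w t (u t - u a)| ≤ 2 * (W * U) := by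
    have hi : Integrable (fun t => ‖w t‖ * ‖u t‖ + ‖w t‖ * ‖u a‖) (volume.restrict (Ioo α β)) :=
      i1.add (i2.mul_const _)
    calc |∫ t in a..b, w t (u t - u a)| = ‖∫ t in uIoc a b, w t (u t - u a)‖ := by
          rw [← Real.norm_eq_abs, intervalIntegral.norm_integral_eq_norm_integral_uIoc]
      _ ≤ ∫ t in uIoc a b, (‖w t‖ * ‖u t‖ + ‖w t‖ * ‖u a‖) := by
          refine norm_integral_le_of_norm_le (hi.mono_measure (Measure.restrict_mono hsub le_rfl))
            (Eventually.of_forall fun t => ?_)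
          rw [← mul_add]
          exact ((w t).le_opNorm _).trans (by gcongr; exact norm_sub_le _ _)
      _ ≤ ∫ t in Ioo α β, (‖w t‖ * ‖u t‖ + ‖w t‖ * ‖u a‖) :=
          setIntegral_mono_set hi (Eventually.of_forall fun t => by positivity)
            (LE.le.eventuallyLE hsub)
      _ = (∫ t in Ioo α β, ‖w t‖ * ‖u t‖) + (∫ t in Ioo α β, ‖w t‖) * ‖u a‖ := by
          rw [integral_add i1 (i2.mul_const _), integral_mul_const]
      _ ≤ W * U + W * √(β - α) * ‖u a‖ := by gcongr
      _ = W * U + W * (√(β - α) * ‖u a‖) := by ring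
      _ ≤ W * U + W * U := by gcongr
      _ = 2 * (W * U) := by ring
  have := (le_abs_self _).trans h3
  linarith

theorem norm_sub_le_of_energy_identity (hDae : ∀ᵐ t ∂(timeMeasure T), t ∈ D)
    (hD : ∀ a ∈ D, ∀ b ∈ D, ∀ e : V,
      ‖j (u b - e)‖ ^ 2 - ‖j (u a - e)‖ ^ 2 = 2 * ∫ t in a..b, w t (u t - e))
    {α β : ℝ} (hJ : Ioo α β ⊆ Ioo 0 T) {b b' : ℝ} (hb : b ∈ D)
    (hbJ : b ∈ Ioo α β) (hb' : b' ∈ D) (hbJ' : b' ∈ Ioo α β) :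
    ‖j (u b) - j (u b')‖ ≤
      4 * √(√(∫ t in Ioo α β, ‖w t‖ ^ 2) * √(∫ t in Ioo α β, ‖u t‖ ^ 2)) := by
  obtain ⟨a, haD, -, ha⟩ := exists_norm_sub_sq_le hDae hD (hbJ.1.trans hbJ.2) hJ
  set ω := √(∫ t in Ioo α β, ‖w t‖ ^ 2) * √(∫ t in Ioo α β, ‖u t‖ ^ 2)
  have key : ∀ c ∈ D, c ∈ Ioo α β → ‖j (u c) - j (u a)‖ ≤ 2 * √ω := by
    intro c hc hcJ
    refine (pow_le_pow_iff_left₀ (norm_nonneg _) (by positivity) two_ne_zero).1 ?_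
    rw [mul_pow, Real.sq_sqrt (by positivity)]
    linarith [ha c hc hcJ]
  have h1 := key b hb hbJ
  have h2 := key b' hb' hbJ'
  rw [← norm_neg, neg_sub] at h2
  calc ‖j (u b) - j (u b')‖ = ‖(j (u b) - j (u a)) + (j (u a) - j (u b'))‖ := by congr 1; abel
    _ ≤ _ := norm_add_le _ _
    _ ≤ _ := by linarith

/-- A subset of `(0, T)` of full measure is dense in `[0, T]`. -/
theorem Icc_subset_closure_of_ae (hT : 0 < T) (hDae : ∀ᵐ t ∂(timeMeasure T), t ∈ D) :
    Icc 0 T ⊆ closure (Ioo 0 T ∩ D) := by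
  rw [timeMeasure, ae_restrict_iff' measurableSet_Ioo] at hDae
  have h1 : Dense {t : ℝ | t ∈ Ioo 0 T → t ∈ D} := Measure.dense_of_ae hDae
  have h2 := h1.open_subset_closure_inter (isOpen_Ioo (a := 0) (b := T))
  rw [← closure_Ioo hT.ne]
  refine closure_minimal (h2.trans (closure_mono fun t ht => ⟨ht.1, ht.2 ht.1⟩)) isClosed_closure

theorem tendsto_setIntegral_ball_zero {f : ℝ → ℝ} (hf : IntegrableOn f (Ioo 0 T)) (x : ℝ) :
    Tendsto (fun δ : ℝ => ∫ t in Ioo (max 0 (x - δ)) (min T (x + δ)), f t) (𝓝[>] 0) (𝓝 0) := by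
  have h := hf.integrable.tendsto_setIntegral_nhds_zero (l := 𝓝[>] (0 : ℝ))
    (s := fun δ => Ioo (x - δ) (x + δ)) ?_
  · refine h.congr fun δ => ?_
    rw [Measure.restrict_restrict measurableSet_Ioo, Ioo_inter_Ioo, max_comm, min_comm]
  · have h0 : Tendsto (fun δ : ℝ => ENNReal.ofReal (x + δ - (x - δ))) (𝓝[>] 0) (𝓝 0) := by
      have : Tendsto (fun δ : ℝ => ENNReal.ofReal (x + δ - (x - δ))) (𝓝 0)
          (𝓝 (ENNReal.ofReal (x + 0 - (x - 0)))) :=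
        (ENNReal.continuous_ofReal.comp (by fun_prop)).tendsto 0
      simpa using this.mono_left nhdsWithin_le_nhds
    refine tendsto_of_tendsto_of_tendsto_of_le_of_le tendsto_const_nhds h0
      (fun _ => zero_le) fun δ => ?_
    exact (Measure.restrict_apply_le _ _).trans (le_of_eq Real.volume_Ioo)

/-- Where the energy identity holds, `u` has limits in `H` at all times of `[0, T]`. -/
theorem exists_tendsto_of_energy_identity [CompleteSpace H] (hT : 0 < T) (hDT : D ⊆ Ioo 0 T)
    (hDae : ∀ᵐ t ∂(timeMeasure T), t ∈ D)
    (hD : ∀ a ∈ D, ∀ b ∈ D, ∀ e : V,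
      ‖j (u b - e)‖ ^ 2 - ‖j (u a - e)‖ ^ 2 = 2 * ∫ t in a..b, w t (u t - e))
    {x : ℝ} (hx : x ∈ Icc 0 T) : ∃ y, Tendsto (fun t => j (u t)) (𝓝[D] x) (𝓝 y) := by
  have hne : (𝓝[D] x).NeBot := by
    rw [← mem_closure_iff_nhdsWithin_neBot]
    exact closure_mono inter_subset_right (Icc_subset_closure_of_ae hT hDae hx)
  refine cauchy_map_iff_exists_tendsto.1 (Metric.cauchy_iff.2 ⟨inferInstance, fun ε hε => ?_⟩)
  have hlim : Tendsto (fun δ : ℝ =>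
      4 * √(√(∫ t in Ioo (max 0 (x - δ)) (min T (x + δ)), ‖w t‖ ^ 2) *
        √(∫ t in Ioo (max 0 (x - δ)) (min T (x + δ)), ‖u t‖ ^ 2))) (𝓝[>] 0) (𝓝 0) := by
    have h1 := tendsto_setIntegral_ball_zero ((Lp.memLp w).integrable_norm_pow two_ne_zero) x
    have h2 := tendsto_setIntegral_ball_zero ((Lp.memLp u).integrable_norm_pow two_ne_zero) x
    simpa using ((h1.sqrt.mul h2.sqrt).sqrt).const_mul 4
  obtain ⟨δ, hδε, hδ⟩ := ((hlim.eventually_lt_const hε).and self_mem_nhdsWithin).exists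
  have hmem : ∀ t ∈ D, t ∈ Ioo (x - δ) (x + δ) → t ∈ Ioo (max 0 (x - δ)) (min T (x + δ)) :=
    fun t ht ht' => ⟨max_lt (hDT ht).1 ht'.1, lt_min (hDT ht).2 ht'.2⟩
  refine ⟨(fun t => j (u t)) '' (D ∩ Ioo (x - δ) (x + δ)), image_mem_map
    (inter_mem_nhdsWithin D ?_), ?_⟩
  · exact Ioo_mem_nhds (sub_lt_self x hδ) (lt_add_of_pos_right x hδ)
  rintro _ ⟨b, hb, rfl⟩ _ ⟨b', hb', rfl⟩
  rw [dist_eq_norm]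
  exact (norm_sub_le_of_energy_identity hDae hD
    (Ioo_subset_Ioo (le_max_left _ _) (min_le_left _ _)) hb.1 (hmem b hb.1 hb.2) hb'.1
    (hmem b' hb'.1 hb'.2)).trans_lt hδε

end Representative

/-! ### The trace operators -/

section Trace

open Filter Topology

variable {V H : Type*} [NormedAddCommGroup V] [InnerProductSpace ℝ V]
  [NormedAddCommGroup H] [InnerProductSpace ℝ H]
  {T : ℝ} {j : V →L[ℝ] H}

/-- The embedding `X ↪ C([0, T]; H)`, together with the energy identity. -/
theorem exists_isContinuousRep [CompleteSpace V] [CompleteSpace H]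
    [TopologicalSpace.SeparableSpace V]
    (hj : Function.Injective j) (hc : IsCompactOperator j) (hT : 0 < T) (u : spaceX T j) :
    ∃ U, IsContinuousRep u U ∧
      ‖U T‖ ^ 2 - ‖U 0‖ ^ 2 = 2 * ∫ t in (0)..T, timeDeriv u t (toY u t) ∧
      ∀ t ∈ Icc 0 T, ‖U t‖ ≤ (4 + ‖j‖ / √T) * ‖u‖ := by
  obtain ⟨D, hDT, hDae, hD⟩ := exists_energy_identity hj hc hT (u := toY u) (w := timeDeriv u) u.2
  have hcl : Icc 0 T ⊆ closure D :=
    (Icc_subset_closure_of_ae hT hDae).trans (closure_mono inter_subset_right)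
  have hDI : D ⊆ Icc 0 T := hDT.trans Ioo_subset_Icc_self
  have hlim : ∀ x ∈ Icc 0 T, ∃ y, Tendsto (fun t => j (toY u t)) (𝓝[D] x) (𝓝 y) := fun x hx =>
    exists_tendsto_of_energy_identity hT hDT hDae hD hx
  set U : ℝ → H := extendFrom D (fun t => j (toY u t))
  have hUc : ContinuousOn U (Icc 0 T) := continuousOn_extendFrom hcl hlim
  have hUD : ∀ t ∈ D, U t = j (toY u t) := by
    intro t ht
    obtain ⟨y, hy⟩ := hlim t (hDI ht)
    have h1 := tendsto_nhds_unique (hy.mono_left (pure_le_nhdsWithin ht))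
      (tendsto_pure_nhds (fun t => j (toY u t)) t)
    refine extendFrom_eq (hcl (hDI ht)) ?_
    rwa [← h1]
  have h0 : (0 : ℝ) ∈ Icc 0 T := ⟨le_rfl, hT.le⟩
  have hT' : T ∈ Icc 0 T := ⟨hT.le, le_rfl⟩
  refine ⟨U, ⟨hUc, by filter_upwards [hDae] with t ht using hUD t ht⟩, ?_, ?_⟩
  · obtain ⟨d, hd⟩ : D.Nonempty := closure_nonempty_iff.1 ⟨0, hcl h0⟩
    set F : ℝ → ℝ := fun t => ∫ r in (0)..t, timeDeriv u r (toY u r)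
    have hint : IntervalIntegrable (fun r => timeDeriv u r (toY u r)) volume 0 T := by
      rw [intervalIntegrable_iff_integrableOn_Ioo_of_le hT.le]
      exact integrable_pairing _ _
    have hF : ContinuousOn F (Icc 0 T) := by
      have := (hint.absolutelyContinuousOnInterval_intervalIntegral (c := 0) (by simp)).continuousOn
      rwa [uIcc_of_le hT.le] at this
    have hI : ∀ t ∈ Icc 0 T,
        IntervalIntegrable (fun r => timeDeriv u r (toY u r)) volume 0 t := fun t ht =>
      hint.mono_set (by rw [uIcc_of_le hT.le, uIcc_of_le ht.1]; exact Icc_subset_Icc_right ht.2)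
    -- `‖U‖² - 2F` is continuous on `[0, T]`, and constant on the dense set `D`.
    have hconst : EqOn (fun t => ‖U t‖ ^ 2 - 2 * F t) (fun _ => ‖U d‖ ^ 2 - 2 * F d) D := by
      intro t ht
      have h1 := hD d hd t ht 0
      simp only [sub_zero] at h1
      rw [← hUD t ht, ← hUD d hd, ← intervalIntegral.integral_interval_sub_left (hI t (hDI ht))
        (hI d (hDI hd))] at h1
      simp only [F]
      linarith
    have hall := hconst.of_subset_closure ((hUc.norm.pow 2).sub (hF.const_mul 2))
      continuousOn_const hDI hcl
    have e0 := hall h0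
    have eT := hall hT'
    have hF0 : F 0 = 0 := intervalIntegral.integral_same
    simp only [hF0] at e0 eT
    simp only [F] at eT
    linarith
  · obtain ⟨a, ha, hmean, -⟩ := exists_norm_sub_sq_le hDae hD hT Subset.rfl
    have hu : ‖toY u‖ ≤ ‖u‖ := norm_fst_le u.1
    have hw : ‖timeDeriv u‖ ≤ ‖u‖ := norm_snd_le u.1
    have hua : ‖toY u a‖ ≤ ‖u‖ / √T := by
      rw [le_div_iff₀ (Real.sqrt_pos.2 hT)]
      refine le_trans ?_ hu
      refine (pow_le_pow_iff_left₀ (by positivity) (norm_nonneg _) two_ne_zero).1 ?_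
      rw [mul_pow, Real.sq_sqrt hT.le, norm_sq_Lp_two]
      linarith
    have hbd : ∀ b ∈ D, ‖U b‖ ≤ (4 + ‖j‖ / √T) * ‖u‖ := by
      intro b hb
      have h1 := norm_sub_le_of_energy_identity hDae hD Subset.rfl hb (hDT hb) ha (hDT ha)
      rw [← norm_sq_Lp_two, ← norm_sq_Lp_two, Real.sqrt_sq (norm_nonneg _),
        Real.sqrt_sq (norm_nonneg _)] at h1
      have h2 : √(‖timeDeriv u‖ * ‖toY u‖) ≤ ‖u‖ := by
        refine Real.sqrt_le_iff.2 ⟨norm_nonneg _, ?_⟩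
        rw [sq]
        gcongr
      rw [hUD b hb]
      calc ‖j (toY u b)‖ = ‖(j (toY u b) - j (toY u a)) + j (toY u a)‖ := by rw [sub_add_cancel]
        _ ≤ ‖j (toY u b) - j (toY u a)‖ + ‖j (toY u a)‖ := norm_add_le _ _
        _ ≤ 4 * ‖u‖ + ‖j‖ * (‖u‖ / √T) :=
          add_le_add (h1.trans (by gcongr)) ((j.le_opNorm _).trans (by gcongr))
        _ = _ := by ring
    intro t ht
    have hne : (𝓝[D] t).NeBot := mem_closure_iff_nhdsWithin_neBot.1 (hcl ht)
    exact le_of_tendsto ((hUc t ht).mono hDI).norm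
      (by filter_upwards [self_mem_nhdsWithin] with b hb using hbd b hb)

theorem IsContinuousRep.eqOn (hT : 0 < T) {u : spaceX T j} {U U' : ℝ → H}
    (hU : IsContinuousRep u U) (hU' : IsContinuousRep u U') : EqOn U U' (Icc 0 T) := by
  have hae : ∀ᵐ t ∂(timeMeasure T), t ∈ {t | U t = U' t} := by
    filter_upwards [hU.2, hU'.2] with t h1 h2
    exact h1.trans h2.symm
  have h : EqOn U U' (Ioo 0 T ∩ {t | U t = U' t}) := fun t ht => ht.2
  exact h.of_subset_closure hU.1 hU'.1 (inter_subset_left.trans Ioo_subset_Icc_self)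
    (Icc_subset_closure_of_ae hT hae)

theorem IsContinuousRep.trace_eq (hT : 0 < T) {u : spaceX T j} {U : ℝ → H}
    (hU : IsContinuousRep u U) {t : ℝ} (ht : t ∈ Icc 0 T) : trace t u = U t := by
  have h : ∃ U, IsContinuousRep u U := ⟨U, hU⟩
  rw [trace, dif_pos h]
  exact h.choose_spec.eqOn hT hU ht

theorem IsContinuousRep.add {u u' : spaceX T j} {U U' : ℝ → H} (hU : IsContinuousRep u U)
    (hU' : IsContinuousRep u' U') : IsContinuousRep (u + u') (U + U') := by
  refine ⟨hU.1.add hU'.1, ?_⟩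
  filter_upwards [hU.2, hU'.2, Lp.coeFn_add (toY u) (toY u')] with t h1 h2 h3
  rw [show toY (u + u') = toY u + toY u' from rfl, h3, Pi.add_apply, Pi.add_apply, map_add, h1, h2]

theorem IsContinuousRep.smul {u : spaceX T j} {U : ℝ → H} (c : ℝ) (hU : IsContinuousRep u U) :
    IsContinuousRep (c • u) (c • U) := by
  refine ⟨hU.1.const_smul c, ?_⟩
  filter_upwards [hU.2, Lp.coeFn_smul c (toY u)] with t h1 h2
  rw [show toY (c • u) = c • toY u from rfl, h2, Pi.smul_apply, Pi.smul_apply, map_smul, h1]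

variable [CompleteSpace V] [CompleteSpace H] [TopologicalSpace.SeparableSpace V]

theorem exists_continuousLinearMap_eq_trace (hj : Function.Injective j) (hc : IsCompactOperator j)
    (hT : 0 < T) {t : ℝ} (ht : t ∈ Icc 0 T) :
    ∃ τ : spaceX T j →L[ℝ] H, ∀ u, τ u = trace t u := by
  choose U hU hE hbd using exists_isContinuousRep hj hc hT
  let τ : spaceX T j →ₗ[ℝ] H :=
    { toFun := trace t
      map_add' := fun u u' => by
        rw [((hU u).add (hU u')).trace_eq hT ht, (hU u).trace_eq hT ht, (hU u').trace_eq hT ht]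
        rfl
      map_smul' := fun c u => by
        rw [((hU u).smul c).trace_eq hT ht, (hU u).trace_eq hT ht]
        rfl }
  refine ⟨τ.mkContinuous (4 + ‖j‖ / √T) fun u => ?_, fun u => rfl⟩
  change ‖trace t u‖ ≤ _
  rw [(hU u).trace_eq hT ht]
  exact hbd u t ht

/-- Integration by parts in time. -/
theorem two_mul_opDt_toY (hj : Function.Injective j) (hc : IsCompactOperator j) (hT : 0 < T)
    (u : spaceX T j) : 2 * opDt u (toY u) = ‖trace T u‖ ^ 2 - ‖trace 0 u‖ ^ 2 := by
  obtain ⟨U, hU, hE, -⟩ := exists_isContinuousRep hj hc hT u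
  rw [hU.trace_eq hT ⟨hT.le, le_rfl⟩, hU.trace_eq hT ⟨le_rfl, hT.le⟩, hE,
    intervalIntegral.integral_of_le hT.le, integral_Ioc_eq_integral_Ioo]
  rfl

end Trace

/-! ### Energy norms and the inf-sup constant in terms of Riesz maps -/

section Norms

variable {V H : Type*} [NormedAddCommGroup V] [InnerProductSpace ℝ V]
  [NormedAddCommGroup H] [InnerProductSpace ℝ H]
  {T : ℝ} {j : V →L[ℝ] H} {a : ℝ → V →ₗ[ℝ] V →ₗ[ℝ] ℝ}

/-- The time derivative `∂ₜ : X → Y'` as a bounded operator. -/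
noncomputable def timeDerivL (T : ℝ) (j : V →L[ℝ] H) : spaceX T j →L[ℝ] StrongDual ℝ (L2I T V) :=
  dualPairing T V ∘L ContinuousLinearMap.snd ℝ _ _ ∘L (spaceX T j).subtypeL

theorem timeDerivL_apply (u : spaceX T j) (v : L2I T V) : timeDerivL T j u v = opDt u v :=
  dualPairing_apply _ _

/-- The embedding of `X` into `Y` as a bounded operator. -/
noncomputable def toYL (T : ℝ) (j : V →L[ℝ] H) : spaceX T j →L[ℝ] L2I T V :=
  ContinuousLinearMap.fst ℝ _ _ ∘L (spaceX T j).subtypeL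

theorem norm_le_norm_toYL_add_norm_timeDerivL [CompleteSpace V] (u : spaceX T j) :
    ‖u‖ ≤ ‖toYL T j u‖ + ‖timeDerivL T j u‖ := by
  have h1 : ‖u.1.2‖ ≤ ‖timeDerivL T j u‖ := norm_le_norm_dualPairing u.1.2
  exact max_le (le_add_of_nonneg_right (norm_nonneg (timeDerivL T j u)))
    (h1.trans (le_add_of_nonneg_left (norm_nonneg (toYL T j u))))

variable {s : L2I T V →L[ℝ] L2I T V →L[ℝ] ℝ} {R R' : StrongDual ℝ (L2I T V) →L[ℝ] L2I T V}
  {W : Submodule ℝ (L2I T V)}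

theorem dualNormDt_eq (hs : IsCoercive s) (hsymm : ∀ u v, s u v = s v u)
    (hsY : ∀ v, normY a v = √(s v v)) (hR : IsRieszMap s ⊤ R) (u : spaceX T j) :
    dualNormDt a u = √(s (R (timeDerivL T j u)) (R (timeDerivL T j u))) := by
  rw [← hR.iSup_div_eq hs hsymm (fun v : {v : L2I T V // v ≠ 0} => v.1) (fun v => ⟨trivial, v.2⟩)
    (fun v _ hv => ⟨⟨v, hv⟩, rfl⟩), dualNormDt]
  simp only [timeDerivL_apply, hsY]

theorem iSup_opDt_div_eq (hs : IsCoercive s) (hsymm : ∀ u v, s u v = s v u)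
    (hsY : ∀ v, normY a v = √(s v v)) (hR : IsRieszMap s ⊤ R) (hR' : IsRieszMap s W R')
    (u : spaceX T j) :
    ⨆ v : {v : L2I T V // v ∈ W ∧ v ≠ 0}, opDt u v.1 / (dualNormDt a u * normY a v.1) =
      √(s (R' (timeDerivL T j u)) (R' (timeDerivL T j u))) /
        √(s (R (timeDerivL T j u)) (R (timeDerivL T j u))) := by
  have h0 : 0 ≤ (dualNormDt a u)⁻¹ := by
    rw [dualNormDt_eq hs hsymm hsY hR]
    positivity
  rw [← dualNormDt_eq hs hsymm hsY hR, ← hR'.iSup_div_eq hs hsymm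
    (fun v : {v : L2I T V // v ∈ W ∧ v ≠ 0} => v.1) (fun v => v.2)
    (fun v hv hv0 => ⟨⟨v, hv, hv0⟩, rfl⟩), div_eq_mul_inv, Real.iSup_mul_of_nonneg h0]
  refine iSup_congr fun v => ?_
  rw [timeDerivL_apply, hsY, ← div_eq_mul_inv, div_div, mul_comm (dualNormDt a u)]

theorem infSup_nonneg (hs : IsCoercive s) (hsymm : ∀ u v, s u v = s v u)
    (hsY : ∀ v, normY a v = √(s v v)) (hR : IsRieszMap s ⊤ R) (hR' : IsRieszMap s W R')
    (Xd : Submodule ℝ (spaceX T j)) : 0 ≤ infSup a W Xd := by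
  rw [infSup]
  split_ifs
  · refine Real.iInf_nonneg fun u => ?_
    rw [iSup_opDt_div_eq hs hsymm hsY hR hR']
    positivity
  · exact zero_le_one

/-- The inf-sup constant compares the discrete and the continuous dual norm of `∂ₜ w`. -/
theorem infSup_mul_le (hs : IsCoercive s) (hsymm : ∀ u v, s u v = s v u)
    (hsY : ∀ v, normY a v = √(s v v)) (hR : IsRieszMap s ⊤ R) (hR' : IsRieszMap s W R')
    {Xd : Submodule ℝ (spaceX T j)} {w : spaceX T j} (hw : w ∈ Xd) :
    infSup a W Xd * √(s (R (timeDerivL T j w)) (R (timeDerivL T j w))) ≤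
      √(s (R' (timeDerivL T j w)) (R' (timeDerivL T j w))) := by
  by_cases h0 : opDt w = 0
  · have : timeDerivL T j w = 0 := by
      ext v
      rw [timeDerivL_apply, h0]
      rfl
    simp [this]
  have hpos : 0 < √(s (R (timeDerivL T j w)) (R (timeDerivL T j w))) := by
    refine Real.sqrt_pos.2 (hs.apply_self_pos fun h => h0 ?_)
    ext v
    rw [← timeDerivL_apply, ← hR.apply_eq _ v trivial, h]
    simp
  rw [← le_div_iff₀ hpos, ← iSup_opDt_div_eq hs hsymm hsY hR hR', infSup, if_pos ⟨w, hw, h0⟩]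
  refine ciInf_le (f := fun u : {u : spaceX T j // u ∈ Xd ∧ opDt u ≠ 0} =>
    ⨆ v : {v : L2I T V // v ∈ W ∧ v ≠ 0}, opDt u.1 v.1 / (dualNormDt a u.1 * normY a v.1))
    ⟨0, forall_mem_range.2 fun u => ?_⟩ ⟨w, hw, h0⟩
  rw [iSup_opDt_div_eq hs hsymm hsY hR hR']
  positivity

theorem infSup_le_one (hs : IsCoercive s) (hsymm : ∀ u v, s u v = s v u)
    (hsY : ∀ v, normY a v = √(s v v)) (hR : IsRieszMap s ⊤ R) (hR' : IsRieszMap s W R')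
    (Xd : Submodule ℝ (spaceX T j)) : infSup a W Xd ≤ 1 := by
  by_cases h : ∃ u ∈ Xd, opDt u ≠ 0
  · obtain ⟨w, hw, h0⟩ := h
    have hpos : 0 < √(s (R (timeDerivL T j w)) (R (timeDerivL T j w))) := by
      refine Real.sqrt_pos.2 (hs.apply_self_pos fun h => h0 ?_)
      ext v
      rw [← timeDerivL_apply, ← hR.apply_eq _ v trivial, h]
      simp
    refine le_of_mul_le_mul_right ?_ hpos
    rw [one_mul]
    exact (infSup_mul_le hs hsymm hsY hR hR' hw).trans
      (Real.sqrt_le_sqrt (hR.apply_le_apply hs hsymm hR' _))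
  · rw [infSup, if_neg h]

end Norms

end SpaceTime

/-! ### The space-time Galerkin method -/

theorem theorem3p6
    {V H : Type*}
    [NormedAddCommGroup V] [InnerProductSpace ℝ V] [CompleteSpace V]
    [TopologicalSpace.SeparableSpace V]
    [NormedAddCommGroup H] [InnerProductSpace ℝ H] [CompleteSpace H]
    [TopologicalSpace.SeparableSpace H]
    -- the dense and compact embedding of `V` into `H`
    (j : V →L[ℝ] H) (hj_inj : Function.Injective j) (hj_dense : DenseRange j)
    (hj_compact : IsCompactOperator j)
    (T : ℝ) (hT : 0 < T)
    -- the bilinear forms `a(t; ·, ·)`: measurable in `t`, uniformly bounded and coercive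
    (a : ℝ → V →ₗ[ℝ] V →ₗ[ℝ] ℝ)
    (ha_meas : ∀ η ζ : V, AEMeasurable (fun t => a t η ζ) (SpaceTime.timeMeasure T))
    (ha_bdd : ∃ M : ℝ, ∀ᵐ t ∂(SpaceTime.timeMeasure T), ∀ η ζ : V, |a t η ζ| ≤ M * ‖η‖ * ‖ζ‖)
    (ha_coer : ∃ c : ℝ, 0 < c ∧
      ∀ᵐ t ∂(SpaceTime.timeMeasure T), ∀ η : V, c * ‖η‖ ^ 2 ≤ a t η η)
    -- `A = A_s`
    (ha_symm : ∀ u v : SpaceTime.L2I T V, SpaceTime.opA a u v = SpaceTime.opAs a u v)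
    -- the family of closed subspaces
    {Δ : Type*}
    (Yd : Δ → Submodule ℝ (SpaceTime.L2I T V))
    (Hd : Δ → Submodule ℝ H)
    (Xd : Δ → Submodule ℝ (SpaceTime.spaceX T j))
    (hYd : ∀ δ, IsClosed (Yd δ : Set (SpaceTime.L2I T V)))
    (hHd : ∀ δ, IsClosed (Hd δ : Set H))
    (hXd : ∀ δ, IsClosed (Xd δ : Set (SpaceTime.spaceX T j)))
    (hXY : ∀ δ, ∀ w ∈ Xd δ, SpaceTime.toY w ∈ Yd δ)
    (hXH : ∀ δ, ∀ w ∈ Xd δ, SpaceTime.trace 0 w ∈ Hd δ)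
    (hγ : 0 < SpaceTime.gammaDelta a Yd Xd)
    (δ : Δ) (g : StrongDual ℝ (SpaceTime.L2I T V)) (u₀ : H) :
    (∃! p : SpaceTime.L2I T V × H × SpaceTime.spaceX T j,
      SpaceTime.IsGalerkinSolution a (Yd δ) (Hd δ) (Xd δ) g u₀ p.1 p.2.1 p.2.2) ∧
    ∀ u : SpaceTime.spaceX T j, SpaceTime.IsSolution a g u₀ u →
      ∀ (μd : SpaceTime.L2I T V) (σd : H) (ud : SpaceTime.spaceX T j),
        SpaceTime.IsGalerkinSolution a (Yd δ) (Hd δ) (Xd δ) g u₀ μd σd ud →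
          SpaceTime.normX a (u - ud) ≤
            (SpaceTime.gammaDelta a Yd Xd)⁻¹ *
              ⨅ w : Xd δ, SpaceTime.normX a (u - w.1) := by
  obtain ⟨s, hs, hsA⟩ := SpaceTime.exists_continuous_bilin_eq_opA ha_meas ha_bdd ha_coer
  have hsymm : ∀ u v, s u v = s v u := fun u v => by
    rw [hsA, hsA, ha_symm u v, ha_symm v u, SpaceTime.opAs, SpaceTime.opAs, add_comm]
  have hsAs : ∀ u v, SpaceTime.opAs a u v = s u v := fun u v => by rw [← ha_symm, hsA]
  have hsY : ∀ v, SpaceTime.normY a v = √(s v v) := fun v => by rw [SpaceTime.normY, hsAs]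
  obtain ⟨τ0, hτ0⟩ := SpaceTime.exists_continuousLinearMap_eq_trace hj_inj hj_compact hT
    (t := 0) ⟨le_rfl, hT.le⟩
  obtain ⟨τT, hτT⟩ := SpaceTime.exists_continuousLinearMap_eq_trace hj_inj hj_compact hT
    (t := T) ⟨hT.le, le_rfl⟩
  set D := SpaceTime.timeDerivL T j
  set ι := SpaceTime.toYL T j
  have hB : ∀ w v, SpaceTime.opB a w v = SpaceTime.parabolicOp s D ι w v := fun w v => by
    rw [SpaceTime.opB_eq_add ha_meas ha_bdd, SpaceTime.parabolicOp_apply,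
      SpaceTime.timeDerivL_apply, hsA]
    rfl
  have henergy : ∀ x, 2 * D x (ι x) = ‖τT x‖ ^ 2 - ‖τ0 x‖ ^ 2 := fun x => by
    rw [hτ0, hτT, ← SpaceTime.two_mul_opDt_toY hj_inj hj_compact hT, SpaceTime.timeDerivL_apply]
    rfl
  obtain ⟨R, hR⟩ := SpaceTime.exists_isRieszMap hs (W := ⊤) isClosed_univ
  have hRd := fun δ => SpaceTime.exists_isRieszMap hs (hYd δ)
  obtain ⟨R', hR'⟩ := hRd δ
  have hγδ : SpaceTime.gammaDelta a Yd Xd ≤ SpaceTime.infSup a (Yd δ) (Xd δ) := by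
    refine ciInf_le ⟨0, forall_mem_range.2 fun δ' => ?_⟩ δ
    obtain ⟨R'', hR''⟩ := hRd δ'
    exact SpaceTime.infSup_nonneg hs hsymm hsY hR hR'' _
  have hγ1 := hγδ.trans (SpaceTime.infSup_le_one hs hsymm hsY hR hR' _)
  set γ := SpaceTime.gammaDelta a Yd Xd
  have hγR : ∀ w ∈ Xd δ, γ ^ 2 * s (R (D w)) (R (D w)) ≤ s (R' (D w)) (R' (D w)) := by
    intro w hw
    have h1 := (mul_le_mul_of_nonneg_right hγδ (Real.sqrt_nonneg _)).trans
      (SpaceTime.infSup_mul_le hs hsymm hsY hR hR' hw)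
    have h2 := pow_le_pow_left₀ (by positivity) h1 2
    rwa [mul_pow, Real.sq_sqrt (hs.apply_self_nonneg _), Real.sq_sqrt (hs.apply_self_nonneg _)]
      at h2
  have hnormX : ∀ x, SpaceTime.normX a x = √(SpaceTime.energyForm s D ι R τT x x) := fun x => by
    rw [SpaceTime.normX, hsY, SpaceTime.dualNormDt_eq hs hsymm hsY hR, ← hτT,
      SpaceTime.energyForm_apply, Real.sq_sqrt (hs.apply_self_nonneg _),
      Real.sq_sqrt (hs.apply_self_nonneg _), real_inner_self_eq_norm_sq]
    rfl
  have hE0 : ∀ x, 0 ≤ SpaceTime.energyForm s D ι R τT x x := fun x =>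
    add_nonneg (add_nonneg (hs.apply_self_nonneg _) (hs.apply_self_nonneg _))
      real_inner_self_nonneg
  have := (hHd δ).completeSpace_coe
  have hXY' : ∀ w ∈ Xd δ, ι w ∈ Yd δ := hXY δ
  have hXH' : ∀ w ∈ Xd δ, τ0 w ∈ Hd δ := fun w hw => by rw [hτ0]; exact hXH δ w hw
  have hgal : ∀ μ σ u, SpaceTime.IsGalerkinSolution a (Yd δ) (Hd δ) (Xd δ) g u₀ μ σ u ↔
      u ∈ Xd δ ∧ μ = R' (g - SpaceTime.parabolicOp s D ι u) ∧
        σ = (Hd δ).starProjection (u₀ - τ0 u) ∧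
        ∀ w ∈ Xd δ, SpaceTime.residualForm s D ι R' τ0 w u =
          s (R' (SpaceTime.parabolicOp s D ι w)) (R' g) + inner ℝ (τ0 w) u₀ := by
    intro μ σ u
    rw [← SpaceTime.galerkin_iff hs hR' hXH']
    simp only [← hB, ← hsAs, hτ0]
    exact ⟨fun h => ⟨h.mem_X, h.mem_Y, h.mem_H, h.eq_Y, h.eq_H, h.eq_X⟩,
      fun ⟨h1, h2, h3, h4, h5, h6⟩ => ⟨h2, h3, h1, h4, h5, h6⟩⟩
  refine ⟨?_, fun u hu μd σd ud hud => ?_⟩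
  · obtain ⟨ud, ⟨hudX, hud⟩, huniq⟩ := SpaceTime.existsUnique_normal_equations (hXd δ) hs hsymm
      henergy SpaceTime.norm_le_norm_toYL_add_norm_timeDerivL hR hR' hXY' hγ hγ1 hγR
      ((s.flip (R' g)).comp (R' ∘L SpaceTime.parabolicOp s D ι) + (innerSL ℝ u₀).comp τ0)
    have hF : ∀ w, ((s.flip (R' g)).comp (R' ∘L SpaceTime.parabolicOp s D ι) +
        (innerSL ℝ u₀).comp τ0) w =
        s (R' (SpaceTime.parabolicOp s D ι w)) (R' g) + inner ℝ (τ0 w) u₀ := fun w => by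
      rw [real_inner_comm]
      rfl
    simp only [hF] at hud huniq
    refine ⟨(R' (g - SpaceTime.parabolicOp s D ι ud), (Hd δ).starProjection (u₀ - τ0 ud), ud),
      (hgal _ _ _).2 ⟨hudX, rfl, rfl, hud⟩, ?_⟩
    rintro ⟨μ, σ, u⟩ h
    obtain ⟨h1, h2, h3, h4⟩ := (hgal _ _ _).1 h
    obtain rfl := huniq u ⟨h1, h4⟩
    exact Prod.ext h2 (Prod.ext h3 rfl)
  · obtain ⟨hudX, -, -, hudeq⟩ := (hgal _ _ _).1 hud
    -- The exact solution is consistent: its data are `B u` and `u(0)`.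
    have hug : g = SpaceTime.parabolicOp s D ι u := by
      ext v
      simpa [hB] using (hu v 0).symm
    have hu0 : u₀ = τ0 u := by
      refine ext_inner_right ℝ fun v => ?_
      have := hu 0 v
      rw [hB, map_zero, map_zero, zero_add, zero_add] at this
      rw [hτ0, this]
    have hn : ∀ x ∈ Xd δ, SpaceTime.residualForm s D ι R' τ0 x ud =
        s (R' (SpaceTime.parabolicOp s D ι x)) (R' (SpaceTime.parabolicOp s D ι u)) +
          inner ℝ (τ0 x) (τ0 u) := by
      rw [← hug, ← hu0]
      exact hudeq
    have hreal : ∀ E F : ℝ, 0 ≤ E → γ ^ 2 * E ≤ F → √E * γ ≤ √F := fun E F hE h => by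
      refine Real.le_sqrt_of_sq_le ?_
      rwa [mul_pow, Real.sq_sqrt hE, mul_comm]
    rw [inv_mul_eq_div, le_div_iff₀ hγ]
    refine le_ciInf fun w => ?_
    rw [hnormX, hnormX]
    exact hreal _ _ (hE0 _) (SpaceTime.sq_mul_energyForm_sub_le hs hsymm henergy hR hR' hXY' hγ hγ1
      hγR hudX w.2 hn)
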